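/- \textbf{Setting.} Fix integers $N,\overline m,\overline l,\overline v\ge 1$ and reals $\varepsilon,\sigma,T>0$; put $\rho=\varepsilon\sigma$, $\mathbb T=[0,T]$, $\mathbb T_-=(-\infty,T]$. The state space is $\mathcal E=\{-1,+1\}\times\{1,\dots,N\}^3\times\{0,\dots,N\}^2$, with states $e=(j,v^b,v^a,p,z,y)$ (last price move, best bid and ask volumes, ask price in ticks, executed part of the previous limit order, inventory). The actions are $\alpha=(m,l)\in\{0,\dots,\overline m\}\times\{0,\dots,\overline l\}$ (market and limit order sizes), the admissible ones in state $e$ form $\mathcal A(e)=\{(m,l): m<v^b,\ m+l\le y\}$, and $\mathcal K=\{(e,\alpha):\alpha\in\mathcal A(e)\}$. For $(e,\alpha)\in\mathcal K$ and $\mathfrak z\in\mathbb N$ the rewards are $$r(e,\alpha)=\rho\,[m(p-1)+z(p-j)],\qquad w(e,\alpha,\mathfrak z)=\rho\,[(p-1)(y-m)+\mathfrak z]-\rho\,\frac{y-m-\mathfrak z}{\overline v}.$$ Let $Q$ be a semi-Markov kernel on $\mathbb R_0^+\times\mathcal E$ given $\mathcal K$: each $Q(t,\cdot\,|\,\cdot)$,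 $t\ge0$, is a sub-Markov kernel; for every $F\subseteq\mathcal E$ and $k\in\mathcal K$ the function $t\mapsto Q(t,F|k)$ is non-decreasing and right-continuous with $Q(0,F|k)=0$; and $\lim_{t\to\infty}Q(t,\cdot\,|\,\cdot)$ is a Markov kernel. Let $P$ be a terminal kernel, i.e. a sub-Markov kernel on $\mathbb N$ given $\mathcal K\times\mathbb T_-$ such that, for all $k=(e,(m,l))\in\mathcal K$: $P(0|k,\lambda)=1$ if $\lambda\le0$; $\sum_{\mathfrak z\ge0}P(\mathfrak z|k,\lambda)=1-Q(\lambda,\mathcal E|k)$ if $\lambda>0$; and $P(\mathfrak z|k,\lambda)=0$ if $\mathfrak z>l$. A decision rule is a measurable map $\phi:(e,\lambda)\in\mathcal E\times\mathbb T_-\mapsto\phi(e,\lambda)\in\mathcal A(e)$ with $\phi(e,\lambda)=(0,0)$ for $\lambda<0$. A policy is a sequence $\pi=(\phi_n)_{n\in\mathbb N}$ of decision rules; $\pi^\phi=(\phi,\phi,\dots)$ is called stationary. Given $(e,\lambda)\in\mathcal E\times\mathbb T$ and $\pi$, a \emph{law of the process} is a probability measure on the space of points $\omega=(\mathfrak N,\mathfrak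 Z,(X_n,E_n,\Lambda_n,A_n)_{n\in\mathbb N})$, where $\mathfrak N,\mathfrak Z\in\mathbb N$, $X_n\ge0$, $(E_n,A_n)\in\mathcal K$ and $\Lambda_n\in\mathbb T_-$, such that almost surely $(X_0,E_0,\Lambda_0)=(0,e,\lambda)$, $\Lambda_{n+1}=\Lambda_n-X_{n+1}$ and $\mathfrak N=\max\{n:\Lambda_n\ge0\}$, and such that, with the history $H_n=((X_i,E_i,\Lambda_i,A_i)_{i<n},X_n,E_n,\Lambda_n)$, for all $n,\mathfrak z\in\mathbb N$, $t\ge0$, $\tilde e\in\mathcal E$ and all actions $\alpha$, almost surely $$\mathbb P(A_n=\alpha\,|\,H_n)=\mathbf 1_{\{\phi_n(E_n,\Lambda_n)=\alpha\}},\qquad \mathbb P(X_{n+1}\le t,\,E_{n+1}=\tilde e\,|\,H_n,A_n)=Q(t,\{\tilde e\}|(E_n,A_n)),$$ $$\mathbb P(X_{n+1}>\Lambda_n\ge0,\ \mathfrak Z=\mathfrak z\,|\,H_n,A_n)=\mathbf 1_{\{\Lambda_n\ge0\}}\,P(\mathfrak z|(E_n,A_n),\Lambda_n).$$ Put $R=\sum_{n=0}^{\mathfrak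 N}r(E_n,A_n)+w(E_{\mathfrak N},A_{\mathfrak N},\mathfrak Z)$. \textbf{Theorem.} \begin{enumerate} \item For every policy $\pi$ and $(e,\lambda)\in\mathcal E\times\mathbb T$ a law of the process exists, $R$ is integrable under each such law, and its expectation $V^\pi(e,\lambda)=\mathbb E[R]$ is the same for all of them. \item The value function $V^*(e,\lambda)=\sup_\pi V^\pi(e,\lambda)$ is finite on $\mathcal E\times\mathbb T$, and it is the unique bounded measurable function $u:\mathcal E\times\mathbb T\to\mathbb R$ with $u(e,\lambda)=\max_{\alpha\in\mathcal A(e)}B_u(e,\alpha,\lambda)$ for all $(e,\lambda)\in\mathcal E\times\mathbb T$, where $$B_u(e,\alpha,\lambda)=r(e,\alpha)+\sum_{\mathfrak z=0}^\infty w(e,\alpha,\mathfrak z)P(\mathfrak z|(e,\alpha),\lambda)+\sum_{\tilde e\in\mathcal E}\int_0^\lambda u(\tilde e,\lambda-t)\,Q(\mathrm dt,\tilde e|(e,\alpha)).$$ \item There is a decision rule $\phi^*$ with $\phi^*(e,\lambda)\in\arg\max_{\alpha\in\mathcal A(e)}B_{V^*}(e,\alpha,\lambda)$ for all $(e,\lambda)\in\mathcal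 E\times\mathbb T$ whose stationary policy is $\mathbb T$-optimal, i.e. $V^{\pi^{\phi^*}}=V^*$ on $\mathcal E\times\mathbb T$. Moreover every decision rule with this maximising property yields a $\mathbb T$-optimal stationary policy. \end{enumerate} -/

import Mathlib

open MeasureTheory ProbabilityTheory
open scoped NNReal ENNReal Topology

noncomputable section

namespace Liquidation

/-! ### Semi-Markov kernels -/

/-- A semi-Markov kernel on `ℝ≥0 × Ω₂` given `Ω₁`: a family `q(t, · | ·)` of sub-Markov kernels,
with `q(·, F | ω)` non-decreasing, right-continuous and null at `0`, whose limit as `t → ∞` is a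
Markov kernel. -/
structure SemiMarkovKernel (Ω₁ Ω₂ : Type*) [MeasurableSpace Ω₁] [MeasurableSpace Ω₂] where
  /-- `kernel t ω F` is the quantity `q(t, F | ω)`. -/
  kernel : ℝ≥0 → Kernel Ω₁ Ω₂
  mono : ∀ (ω : Ω₁) (F : Set Ω₂), MeasurableSet F → Monotone fun t => kernel t ω F
  right_cont : ∀ (ω : Ω₁) (F : Set Ω₂), MeasurableSet F → ∀ t : ℝ≥0,
    ContinuousWithinAt (fun t => kernel t ω F) (Set.Ici t) t
  zero : ∀ (ω : Ω₁) (F : Set Ω₂), MeasurableSet F → kernel 0 ω F = 0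
  sub_markov : ∀ (t : ℝ≥0) (ω : Ω₁), kernel t ω Set.univ ≤ 1
  limit_markov : ∃ κ : Kernel Ω₁ Ω₂, IsMarkovKernel κ ∧
    ∀ (ω : Ω₁) (F : Set Ω₂), MeasurableSet F →
      Filter.Tendsto (fun t => kernel t ω F) Filter.atTop (𝓝 (κ ω F))

namespace SemiMarkovKernel

variable {Ω₁ Ω₂ : Type*} [MeasurableSpace Ω₁] [MeasurableSpace Ω₂]

theorem kernel_ne_top (q : SemiMarkovKernel Ω₁ Ω₂) (t : ℝ≥0) (ω : Ω₁) (F : Set Ω₂) :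
    q.kernel t ω F ≠ ⊤ :=
  ((measure_mono (Set.subset_univ F)).trans (q.sub_markov t ω)).trans_lt ENNReal.one_lt_top |>.ne

/-- The right-continuous non-decreasing function `t ↦ q(t, {x} | ω)`. -/
def stieltjes [MeasurableSingletonClass Ω₂] (q : SemiMarkovKernel Ω₁ Ω₂) (ω : Ω₁) (x : Ω₂) :
    StieltjesFunction ℝ≥0 where
  toFun t := (q.kernel t ω {x}).toReal
  mono' := fun _ t h => ENNReal.toReal_mono (q.kernel_ne_top t ω {x})
    (q.mono ω {x} (measurableSet_singleton x) h)
  right_continuous' := fun t =>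
    (ENNReal.tendsto_toReal (q.kernel_ne_top t ω {x})).comp
      (q.right_cont ω {x} (measurableSet_singleton x) t)

/-- The Lebesgue–Stieltjes measure `q(dt, {x} | ω)` on `ℝ≥0`. -/
def timeMeasure [MeasurableSingletonClass Ω₂] (q : SemiMarkovKernel Ω₁ Ω₂) (ω : Ω₁) (x : Ω₂) :
    Measure ℝ≥0 :=
  (q.stieltjes ω x).measure

end SemiMarkovKernel

/-! ### The market model: states, actions, rewards -/

/-- The constants of the liquidation problem. -/
structure Market where
  /-- bound `N` on the coordinates of the state -/
  N : ℕ
  /-- largest size of a single market order -/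
  mbar : ℕ
  /-- largest size of a single limit order -/
  lbar : ℕ
  /-- average depth on the bid side -/
  vbar : ℕ
  /-- tick size -/
  tick : ℝ
  /-- lot size -/
  lot : ℝ
  /-- maturity `T` -/
  T : ℝ
  N_pos : 0 < N
  mbar_pos : 0 < mbar
  lbar_pos : 0 < lbar
  vbar_pos : 0 < vbar
  tick_pos : 0 < tick
  lot_pos : 0 < lot
  T_pos : 0 < T

variable (M : Market)

/-- The constant `ρ = εσ`. -/
def Market.rho : ℝ := M.tick * M.lot

/-- The set `𝕋 = [0, T]`. -/
abbrev Market.Horizon : Type := Set.Icc (0 : ℝ) M.T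

/-- The set `𝕋₋ = (-∞, T]` of all possible times to maturity. -/
abbrev Market.TimeToGo : Type := Set.Iic M.T

/-- The inclusion `𝕋 ⊆ 𝕋₋`. -/
def Market.Horizon.toTimeToGo {M : Market} (lam : M.Horizon) : M.TimeToGo := ⟨lam, lam.2.2⟩

/-- The state space `{-1, +1} × {1, …, N}³ × {0, …, N}²`. -/
structure State where
  /-- direction of the last price move (`ℤˣ = {-1, +1}`) -/
  j : ℤˣ
  /-- best bid volume -/
  vb : Set.Icc 1 M.N
  /-- best ask volume -/
  va : Set.Icc 1 M.N
  /-- ask price in ticks -/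
  p : Set.Icc 1 M.N
  /-- executed part of the agent's previous limit order -/
  z : Set.Icc 0 M.N
  /-- remaining inventory -/
  y : Set.Icc 0 M.N

/-- Market order size `m ∈ {0, …, mbar}` and limit order size `l ∈ {0, …, lbar}`. -/
structure Action where
  m : Set.Icc 0 M.mbar
  l : Set.Icc 0 M.lbar

/-- The state space as a product. -/
def stateEquiv : State M ≃ ℤˣ × Set.Icc 1 M.N × Set.Icc 1 M.N × Set.Icc 1 M.N ×
    Set.Icc 0 M.N × Set.Icc 0 M.N where
  toFun e := (e.j, e.vb, e.va, e.p, e.z, e.y)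
  invFun x := ⟨x.1, x.2.1, x.2.2.1, x.2.2.2.1, x.2.2.2.2.1, x.2.2.2.2.2⟩
  left_inv _ := rfl
  right_inv _ := rfl

/-- The action space as a product. -/
def actionEquiv : Action M ≃ Set.Icc 0 M.mbar × Set.Icc 0 M.lbar where
  toFun a := (a.m, a.l)
  invFun x := ⟨x.1, x.2⟩
  left_inv _ := rfl
  right_inv _ := rfl

instance : Fintype (State M) := Fintype.ofEquiv _ (stateEquiv M).symm
instance : Fintype (Action M) := Fintype.ofEquiv _ (actionEquiv M).symm
instance : MeasurableSpace (State M) := ⊤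
instance : MeasurableSpace (Action M) := ⊤
instance : DiscreteMeasurableSpace (State M) := ⟨fun _ => trivial⟩
instance : DiscreteMeasurableSpace (Action M) := ⟨fun _ => trivial⟩

variable {M}

/-- The action `(0, 0)`. -/
def Action.none : Action M := ⟨⟨0, by simp⟩, ⟨0, by simp⟩⟩

/-- Admissibility of an action: `m < v^b` and `m + l ≤ y`. -/
def Admissible (e : State M) (a : Action M) : Prop :=
  (a.m : ℕ) < (e.vb : ℕ) ∧ (a.m : ℕ) + (a.l : ℕ) ≤ (e.y : ℕ)

variable (M) in
/-- The set `K` of feasible state-action pairs. -/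
abbrev Feasible : Type := {k : State M × Action M // Admissible k.1 k.2}

/-- The state of a feasible pair. -/
def Feasible.state (k : Feasible M) : State M := k.1.1

/-- The action of a feasible pair. -/
def Feasible.action (k : Feasible M) : Action M := k.1.2

/-- The periodic reward `r(e, α) = ρ [m (p - 1) + z (p - j)]`. -/
def periodicReward (k : Feasible M) : ℝ :=
  M.rho * ((k.action.m : ℕ) * (((k.state.p : ℕ) : ℝ) - 1) +
    (k.state.z : ℕ) * (((k.state.p : ℕ) : ℝ) - ((k.state.j : ℤ) : ℝ)))

variable (M) in
/-- The linear market impact `g(x) = ρ x / vbar`. -/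
def impact (x : ℝ) : ℝ := M.rho * (x / (M.vbar : ℝ))

/-- The terminal reward `w(e, α, 𝔷) = ρ [(p - 1)(y - m) + 𝔷] - g (y - m - 𝔷)`. -/
def terminalReward (k : Feasible M) (zz : ℕ) : ℝ :=
  M.rho * ((((k.state.p : ℕ) : ℝ) - 1) * (((k.state.y : ℕ) : ℝ) - (k.action.m : ℕ)) + zz) -
    impact M (((k.state.y : ℕ) : ℝ) - (k.action.m : ℕ) - zz)

/-! ### Terminal kernels -/

/-- `P` is a terminal kernel compatible with the semi-Markov kernel `Q`: a sub-Markov kernel, where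
`P(𝔷 | k, λ)` stands for the probability that the next decision epoch is more than `λ` away and
that `𝔷` units of the current limit order, of size `l`, are executed by maturity. -/
structure IsTerminalKernel (Q : SemiMarkovKernel (Feasible M) (State M))
    (P : Kernel (Feasible M × M.TimeToGo) ℕ) : Prop where
  sub_markov : ∀ x, P x Set.univ ≤ 1
  of_nonpos : ∀ (k : Feasible M) (lam : M.TimeToGo), (lam : ℝ) ≤ 0 → P (k, lam) {0} = 1
  of_pos : ∀ (k : Feasible M) (lam : M.TimeToGo), 0 < (lam : ℝ) →
    ∑' zz : ℕ, P (k, lam) {zz} = 1 - Q.kernel (lam : ℝ).toNNReal k Set.univ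
  of_gt : ∀ (k : Feasible M) (lam : M.TimeToGo) (zz : ℕ), (k.action.l : ℕ) < zz →
    P (k, lam) {zz} = 0

/-! ### Policies -/

variable (M) in
/-- A decision rule: a measurable map `(e, λ) ↦ φ(e, λ) ∈ A(e)` on `E × 𝕋₋` which is `(0, 0)` for
`λ < 0`. -/
structure DecisionRule where
  toFun : State M → M.TimeToGo → Action M
  measurable : Measurable fun x : State M × M.TimeToGo => toFun x.1 x.2
  admissible : ∀ e lam, Admissible e (toFun e lam)
  of_neg : ∀ (e : State M) (lam : M.TimeToGo), (lam : ℝ) < 0 → toFun e lam = Action.none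

variable (M) in
/-- A horizon-related Markov deterministic policy: a sequence of decision rules. -/
abbrev Policy : Type := ℕ → DecisionRule M

/-- The stationary policy `{φ, φ, …}`. -/
def stationary (φ : DecisionRule M) : Policy M := fun _ => φ

/-! ### The controlled process -/

variable (M) in
/-- Sample points `(𝔫, 𝔷, (t_n, (e_n, α_n), λ_n)_n)` with `α_n ∈ A(e_n)`. -/
abbrev Path : Type := ℕ × ℕ × (ℕ → ℝ≥0 × Feasible M × M.TimeToGo)

namespace Path

/-- Index `𝔑` of the last decision epoch. -/
def lastIndex (ω : Path M) : ℕ := ω.1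

/-- Amount `𝔷` of the limit order executed between the last decision epoch and maturity. -/
def executed (ω : Path M) : ℕ := ω.2.1

/-- Time between the decision epochs `n - 1` and `n`. -/
def X (n : ℕ) (ω : Path M) : ℝ≥0 := (ω.2.2 n).1

/-- State-action pair at epoch `n`. -/
def pair (n : ℕ) (ω : Path M) : Feasible M := (ω.2.2 n).2.1

/-- State at epoch `n`. -/
def E (n : ℕ) (ω : Path M) : State M := (pair n ω).state

/-- Action at epoch `n`. -/
def A (n : ℕ) (ω : Path M) : Action M := (pair n ω).action

/-- Time to maturity at epoch `n`. -/
def Lam (n : ℕ) (ω : Path M) : M.TimeToGo := (ω.2.2 n).2.2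

/-- The history `H_n = ((X_i, E_i, Λ_i, A_i)_{i < n}, (X_n, E_n, Λ_n))`. -/
def hist (n : ℕ) (ω : Path M) :
    (Fin n → ℝ≥0 × State M × M.TimeToGo × Action M) × (ℝ≥0 × State M × M.TimeToGo) :=
  (fun i => (X i ω, E i ω, Lam i ω, A i ω), (X n ω, E n ω, Lam n ω))

variable (M) in
/-- The σ-algebra generated by `H_n`. -/
abbrev histSigma (n : ℕ) : MeasurableSpace (Path M) :=
  MeasurableSpace.comap (hist n) inferInstance

variable (M) in
/-- The σ-algebra generated by `(H_n, A_n)`. -/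
abbrev histActSigma (n : ℕ) : MeasurableSpace (Path M) :=
  MeasurableSpace.comap (fun ω => (hist n ω, A n ω)) inferInstance

/-- Total reward `∑_{n ≤ 𝔑} r(E_n, A_n) + w(E_𝔑, A_𝔑, 𝔷)`. -/
def reward (ω : Path M) : ℝ :=
  ∑ n ∈ Finset.range (lastIndex ω + 1), periodicReward (pair n ω) +
    terminalReward (pair (lastIndex ω) ω) (executed ω)

end Path

open Liquidation.Path in
/-- `μ` is a law of the semi-Markov decision process with kernels `Q`, `P` under the policy `π`,
started from the state `e` with time to maturity `λ`. The terminal kernel acts at the epochs that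
do not lie after maturity. -/
structure IsLaw (Q : SemiMarkovKernel (Feasible M) (State M))
    (P : Kernel (Feasible M × M.TimeToGo) ℕ) (π : Policy M) (e : State M) (lam : M.Horizon)
    (μ : Measure (Path M)) : Prop where
  prob : IsProbabilityMeasure μ
  init : ∀ᵐ ω ∂μ, X 0 ω = 0 ∧ E 0 ω = e ∧ Lam 0 ω = lam.toTimeToGo
  time_step : ∀ n, ∀ᵐ ω ∂μ, (Lam (n + 1) ω : ℝ) = Lam n ω - X (n + 1) ω
  last_index : ∀ᵐ ω ∂μ, IsGreatest {n : ℕ | 0 ≤ (Lam n ω : ℝ)} (lastIndex ω)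
  action : ∀ (n : ℕ) (a : Action M),
    μ⟦{ω | A n ω = a} | histSigma M n⟧ =ᵐ[μ]
      {ω | (π n).toFun (E n ω) (Lam n ω) = a}.indicator fun _ => (1 : ℝ)
  transition : ∀ (n : ℕ) (t : ℝ≥0) (e' : State M),
    μ⟦{ω | X (n + 1) ω ≤ t ∧ E (n + 1) ω = e'} | histActSigma M n⟧ =ᵐ[μ]
      fun ω => (Q.kernel t (pair n ω) {e'}).toReal
  terminal : ∀ n zz : ℕ,
    μ⟦{ω | 0 ≤ (Lam n ω : ℝ) ∧ (Lam n ω : ℝ) < X (n + 1) ω ∧ executed ω = zz} |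
        histActSigma M n⟧ =ᵐ[μ]
      {ω | 0 ≤ (Lam n ω : ℝ)}.indicator fun ω => (P (pair n ω, Lam n ω) {zz}).toReal

/-! ### Value function and optimality -/

open scoped Classical in
/-- The expected reward `V^π(e, λ)`: the expectation of the total reward under a law of the
process (and `0` if there is no law). -/
def expectedReward (Q : SemiMarkovKernel (Feasible M) (State M))
    (P : Kernel (Feasible M × M.TimeToGo) ℕ) (π : Policy M) (e : State M) (lam : M.Horizon) : ℝ :=
  if h : ∃ μ, IsLaw Q P π e lam μ then ∫ ω, Path.reward ω ∂h.choose else 0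

/-- The value function `V*(e, λ) = sup_π V^π(e, λ)`. -/
def valueFunction (Q : SemiMarkovKernel (Feasible M) (State M))
    (P : Kernel (Feasible M × M.TimeToGo) ℕ) (e : State M) (lam : M.Horizon) : ℝ :=
  ⨆ π : Policy M, expectedReward Q P π e lam

/-- A policy is `𝕋`-optimal if it attains the value function everywhere on `E × 𝕋`. -/
def IsOptimal (Q : SemiMarkovKernel (Feasible M) (State M))
    (P : Kernel (Feasible M × M.TimeToGo) ℕ) (π : Policy M) : Prop :=
  ∀ e lam, expectedReward Q P π e lam = valueFunction Q P e lam

/-- The one-step expression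
`r(k) + ∑_𝔷 w(k, 𝔷) P(𝔷 | k, λ) + ∑_{e'} ∫_{[0, λ]} u(e', λ - t) Q(dt, e' | k)`. On the domain of
integration `λ - t` lies in `[0, T]`, so the projection onto `[0, T]` does not change it. -/
def bellman (Q : SemiMarkovKernel (Feasible M) (State M))
    (P : Kernel (Feasible M × M.TimeToGo) ℕ) (u : State M → M.Horizon → ℝ)
    (k : Feasible M) (lam : M.Horizon) : ℝ :=
  periodicReward k +
    ∑' zz : ℕ, terminalReward k zz * (P (k, lam.toTimeToGo) {zz}).toReal +
    ∑ e' : State M, ∫ t in {t : ℝ≥0 | (t : ℝ) ≤ lam},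
      u e' (Set.projIcc 0 M.T M.T_pos.le ((lam : ℝ) - t)) ∂(Q.timeMeasure k e')

/-- `u` is a bounded measurable solution of the optimality equation
`u(e, λ) = max_{α ∈ A(e)} bellman u ((e, α), λ)`. -/
structure IsBellmanSolution (Q : SemiMarkovKernel (Feasible M) (State M))
    (P : Kernel (Feasible M × M.TimeToGo) ℕ) (u : State M → M.Horizon → ℝ) : Prop where
  measurable : ∀ e, Measurable (u e)
  bounded : ∃ C : ℝ, ∀ e lam, |u e lam| ≤ C
  eq_max : ∀ e lam, IsGreatest
    {x : ℝ | ∃ (a : Action M) (h : Admissible e a), x = bellman Q P u ⟨(e, a), h⟩ lam} (u e lam)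

/-- For every `(e, λ) ∈ E × 𝕋`, `φ(e, λ)` maximises over `A(e)` the one-step expression built from
the value function. -/
def IsGreedy (Q : SemiMarkovKernel (Feasible M) (State M))
    (P : Kernel (Feasible M × M.TimeToGo) ℕ) (φ : DecisionRule M) : Prop :=
  ∀ (e : State M) (lam : M.Horizon) (a : Action M) (h : Admissible e a),
    bellman Q P (valueFunction Q P) ⟨(e, a), h⟩ lam ≤
      bellman Q P (valueFunction Q P)
        ⟨(e, φ.toFun e lam.toTimeToGo), φ.admissible e lam.toTimeToGo⟩ lam

end Liquidation

end

open MeasureTheory ProbabilityTheory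
open scoped NNReal ENNReal Topology

noncomputable section

namespace Liquidation

/-! ### The joint law of sojourn time and next state -/

namespace SemiMarkovKernel

variable {Ω₁ Ω₂ : Type*} [MeasurableSpace Ω₁] [MeasurableSpace Ω₂]

/-! One estimate carries the argument. Since `Q` vanishes at time `0`, sojourn times are almost
surely positive, so `e^{-t}` has mean strictly below `1` under the joint law of sojourn time and
next state. There are finitely many feasible pairs, hence one constant `β < 1` serves them all
(`exists_discount_integral`). With the weight `e^λ` this is used twice. The optimality operator
contracts by `β` in the norm `sup |u| e^{-λ}` (`abs_optimalOp_sub_le`), so value iteration converges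
to a solution of the optimality equation. And the probability that epoch `n` does not lie after
maturity is at most `β^n e^T` (`measureReal_alive_le`), so almost surely finitely many epochs count
and the reward is integrable.

A policy is evaluated by cutting the reward into stage rewards. Conditioning at epoch `n` gives a
one-step identity (`integral_stageReward_add`). It telescopes (`sum_integral_stageReward`): the
first `N` expected stage rewards plus the expectation of `u` at epoch `N`, set to zero after
maturity, equal the composed operators of the first `N` rules applied to `u`. The remainder tends to
zero, so the expected reward is the limit of these compositions (`tendsto_policyIter`), which do not
involve the law.

If `u` solves the optimality equation, every rule's operator sends `u` below `u`, and monotonicity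
bounds every policy's reward by `u`. A measurable maximising rule fixes `u`, so its stationary
policy earns exactly `u`. Hence every solution is the value function: uniqueness and optimality of
greedy rules come together.

A law is constructed by the Ionescu-Tulcea theorem on a sequence of noises, each consisting of a
jump and an independent candidate for the executed volume drawn from the normalised terminal kernel.
For `λ ≥ 0` that kernel has mass `1 - Q(λ, E | k)`, the probability that the sojourn exceeds `λ`, so
the product of the two restores `P`. -/

theorem stieltjes_tendsto_atBot [MeasurableSingletonClass Ω₂] (q : SemiMarkovKernel Ω₁ Ω₂)
    (ω : Ω₁) (x : Ω₂) : Filter.Tendsto (q.stieltjes ω x) Filter.atBot (𝓝 0) := by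
  have h0 : q.stieltjes ω x 0 = 0 := by
    change (q.kernel 0 ω {x}).toReal = 0
    simp [q.zero ω {x} (measurableSet_singleton x)]
  -- In `ℝ≥0` the limit at the bottom is the value at the least element `0`, where `q` vanishes.
  have : (Filter.atBot : Filter ℝ≥0) = pure 0 := Filter.OrderBot.atBot_eq ℝ≥0
  rw [this, ← h0]
  exact tendsto_pure_nhds _ _

theorem timeMeasure_Iic [MeasurableSingletonClass Ω₂] (q : SemiMarkovKernel Ω₁ Ω₂)
    (ω : Ω₁) (x : Ω₂) (t : ℝ≥0) : q.timeMeasure ω x (Set.Iic t) = q.kernel t ω {x} := by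
  rw [timeMeasure, StieltjesFunction.measure_Iic _ (q.stieltjes_tendsto_atBot ω x), sub_zero]
  exact ENNReal.ofReal_toReal (q.kernel_ne_top t ω {x})

theorem timeMeasure_univ_le [MeasurableSingletonClass Ω₂] (q : SemiMarkovKernel Ω₁ Ω₂)
    (ω : Ω₁) (x : Ω₂) : q.timeMeasure ω x Set.univ ≤ 1 := by
  refine le_of_tendsto' (tendsto_measure_Iic_atTop (q.timeMeasure ω x)) fun t => ?_
  rw [timeMeasure_Iic]
  exact (measure_mono (Set.subset_univ _)).trans (q.sub_markov t ω)

instance [MeasurableSingletonClass Ω₂] (q : SemiMarkovKernel Ω₁ Ω₂) (ω : Ω₁) (x : Ω₂) :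
    IsFiniteMeasure (q.timeMeasure ω x) :=
  ⟨(q.timeMeasure_univ_le ω x).trans_lt ENNReal.one_lt_top⟩

variable [Fintype Ω₂] [MeasurableSingletonClass Ω₂]

/-- The joint law of the sojourn time and the next state. -/
def jumpMeasure (q : SemiMarkovKernel Ω₁ Ω₂) (ω : Ω₁) : Measure (ℝ≥0 × Ω₂) :=
  ∑ x : Ω₂, (q.timeMeasure ω x).map fun t => (t, x)

theorem jumpMeasure_apply (q : SemiMarkovKernel Ω₁ Ω₂) (ω : Ω₁) {s : Set (ℝ≥0 × Ω₂)}
    (hs : MeasurableSet s) :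
    q.jumpMeasure ω s = ∑ x : Ω₂, q.timeMeasure ω x {t | (t, x) ∈ s} := by
  rw [jumpMeasure, Measure.finsetSum_apply]
  refine Finset.sum_congr rfl fun x _ => ?_
  rw [Measure.map_apply (by fun_prop) hs]
  rfl

theorem jumpMeasure_Iic_prod (q : SemiMarkovKernel Ω₁ Ω₂) (ω : Ω₁) (t : ℝ≥0) (F : Set Ω₂) :
    q.jumpMeasure ω (Set.Iic t ×ˢ F) = q.kernel t ω F := by
  classical
  rw [q.jumpMeasure_apply ω (measurableSet_Iic.prod F.toFinite.measurableSet)]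
  have h : ∀ x, q.timeMeasure ω x {s | (s, x) ∈ Set.Iic t ×ˢ F} =
      if x ∈ F then q.kernel t ω {x} else 0 := by
    intro x
    by_cases hx : x ∈ F
    · simp only [Set.mem_prod, hx, and_true, if_true]
      exact q.timeMeasure_Iic ω x t
    · simp [hx]
  simp only [h]
  rw [← Finset.sum_filter, sum_measure_singleton]
  simp

theorem jumpMeasure_le (q : SemiMarkovKernel Ω₁ Ω₂) (ω : Ω₁) (t : ℝ≥0) :
    q.jumpMeasure ω {z | z.1 ≤ t} = q.kernel t ω Set.univ := by
  rw [← jumpMeasure_Iic_prod]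
  congr 1
  ext z
  simp

/-- The total mass is the limit of `q(t, Ω₂ | ω)` as `t → ∞`, and the limit kernel is Markov. -/
instance (q : SemiMarkovKernel Ω₁ Ω₂) (ω : Ω₁) : IsProbabilityMeasure (q.jumpMeasure ω) := by
  constructor
  have h1 : Filter.Tendsto (fun t => q.jumpMeasure ω {z | z.1 ≤ t}) Filter.atTop
      (𝓝 (q.jumpMeasure ω Set.univ)) := by
    have : (Set.univ : Set (ℝ≥0 × Ω₂)) = ⋃ t : ℝ≥0, {z | z.1 ≤ t} := by
      ext z
      simp only [Set.mem_univ, Set.mem_iUnion, Set.mem_ofPred_eq, true_iff]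
      exact ⟨z.1, le_rfl⟩
    rw [this]
    exact tendsto_measure_iUnion_atTop fun s t hst z (hz : z.1 ≤ s) => hz.trans hst
  simp only [jumpMeasure_le] at h1
  obtain ⟨κ, hκ, h2⟩ := q.limit_markov
  rw [tendsto_nhds_unique h1 (h2 ω _ MeasurableSet.univ), measure_univ]

/-- This is where `q(0, ·) = 0` enters as a strict inequality; the discount factor below `1` comes
from it. -/
theorem jumpMeasure_time_zero (q : SemiMarkovKernel Ω₁ Ω₂) (ω : Ω₁) :
    ∀ᵐ z ∂q.jumpMeasure ω, 0 < z.1 := by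
  rw [ae_iff]
  have h := q.jumpMeasure_le ω 0
  rw [q.zero ω _ MeasurableSet.univ] at h
  simpa using h

/-- The joint law of the sojourn time and the next state, as a kernel. -/
def jumpKernel [Countable Ω₁] [DiscreteMeasurableSpace Ω₁] (q : SemiMarkovKernel Ω₁ Ω₂) :
    Kernel Ω₁ (ℝ≥0 × Ω₂) :=
  ⟨q.jumpMeasure, Measurable.of_discrete⟩

theorem jumpKernel_apply [Countable Ω₁] [DiscreteMeasurableSpace Ω₁]
    (q : SemiMarkovKernel Ω₁ Ω₂) (ω : Ω₁) : q.jumpKernel ω = q.jumpMeasure ω := rfl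

instance [Countable Ω₁] [DiscreteMeasurableSpace Ω₁] (q : SemiMarkovKernel Ω₁ Ω₂) :
    IsMarkovKernel q.jumpKernel :=
  ⟨fun ω => inferInstanceAs (IsProbabilityMeasure (q.jumpMeasure ω))⟩

theorem integral_jumpMeasure (q : SemiMarkovKernel Ω₁ Ω₂) (ω : Ω₁)
    {f : ℝ≥0 × Ω₂ → ℝ} (hf : Measurable f) (hi : Integrable f (q.jumpMeasure ω)) :
    ∫ z, f z ∂q.jumpMeasure ω = ∑ x : Ω₂, ∫ t, f (t, x) ∂q.timeMeasure ω x := by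
  rw [jumpMeasure] at hi ⊢
  rw [integral_finsetSum_measure fun x hx =>
    (integrable_finsetSum_measure.1 hi) x hx]
  refine Finset.sum_congr rfl fun x _ => ?_
  rw [integral_map (by fun_prop) hf.aestronglyMeasurable]

/-- Discounting makes the jump law strictly sub-Markov, uniformly in the starting point. -/
theorem exists_discount [Finite Ω₁] (q : SemiMarkovKernel Ω₁ Ω₂) :
    ∃ β : ℝ≥0, β < 1 ∧ ∀ ω,
      ∫⁻ z, ENNReal.ofReal (Real.exp (-(z.1 : ℝ))) ∂q.jumpMeasure ω ≤ β := by
  have hm : Measurable fun z : ℝ≥0 × Ω₂ => ENNReal.ofReal (Real.exp (-(z.1 : ℝ))) := by fun_prop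
  have key : ∀ ω, ∫⁻ z, ENNReal.ofReal (Real.exp (-(z.1 : ℝ))) ∂q.jumpMeasure ω < 1 := by
    intro ω
    have h1 : ∫⁻ _, (1 : ℝ≥0∞) ∂q.jumpMeasure ω = 1 := by simp
    conv_rhs => rw [← h1]
    have hlt : ∀ᵐ z ∂q.jumpMeasure ω, ENNReal.ofReal (Real.exp (-(z.1 : ℝ))) < 1 := by
      filter_upwards [q.jumpMeasure_time_zero ω] with z hz
      rw [ENNReal.ofReal_lt_one, Real.exp_lt_one_iff]
      simpa using hz
    refine lintegral_strict_mono (IsProbabilityMeasure.ne_zero _) (by fun_prop) ?_ hlt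
    refine ne_of_lt (lt_of_le_of_lt (lintegral_mono_ae (hlt.mono fun z hz => hz.le)) ?_)
    simp
  choose! b hb using fun ω => ENNReal.lt_iff_exists_nnreal_btwn.1 (key ω)
  obtain _ | _ := isEmpty_or_nonempty Ω₁
  · exact ⟨0, one_pos, fun ω => isEmptyElim ω⟩
  -- Finiteness of `Ω₁` turns the pointwise bounds into a uniform one.
  obtain ⟨ω₀, h₀⟩ := Finite.exists_max b
  refine ⟨b ω₀, by exact_mod_cast (hb ω₀).2, fun ω => (hb ω).1.le.trans ?_⟩
  exact_mod_cast h₀ ω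

theorem integrable_exp_neg_jumpMeasure (q : SemiMarkovKernel Ω₁ Ω₂) (ω : Ω₁) :
    Integrable (fun z : ℝ≥0 × Ω₂ => Real.exp (-(z.1 : ℝ))) (q.jumpMeasure ω) := by
  refine Integrable.of_bound (C := 1) (by fun_prop) (ae_of_all _ fun z => ?_)
  rw [Real.norm_of_nonneg (Real.exp_pos _).le, Real.exp_le_one_iff]
  simp

theorem exists_discount_integral [Finite Ω₁] (q : SemiMarkovKernel Ω₁ Ω₂) :
    ∃ β : ℝ, 0 ≤ β ∧ β < 1 ∧ ∀ ω, ∫ z, Real.exp (-(z.1 : ℝ)) ∂q.jumpMeasure ω ≤ β := by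
  obtain ⟨β, hβ, h⟩ := q.exists_discount
  refine ⟨β, β.2, by exact_mod_cast hβ, fun ω => ?_⟩
  rw [integral_eq_lintegral_of_nonneg_ae (ae_of_all _ fun z => (Real.exp_pos _).le) (by fun_prop)]
  exact ENNReal.toReal_le_coe_of_le_coe (h ω)

end SemiMarkovKernel

variable {M : Market}

/-! ### Bounded measurable functions and their extension by zero -/

/-- Bounded measurable functions on `E × 𝕋`. -/
structure IsBddMeasurable (u : State M → M.Horizon → ℝ) : Prop where
  measurable : ∀ e, Measurable (u e)
  bounded : ∃ C : ℝ, ∀ e lam, |u e lam| ≤ C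

/-- The extension of `u` by zero to negative times to maturity. -/
def extendZero (u : State M → M.Horizon → ℝ) (e : State M) (x : ℝ) : ℝ :=
  (Set.Ici (0 : ℝ)).indicator (fun x => u e (Set.projIcc 0 M.T M.T_pos.le x)) x

theorem extendZero_of_neg (u : State M → M.Horizon → ℝ) (e : State M) {x : ℝ} (hx : x < 0) :
    extendZero u e x = 0 :=
  Set.indicator_of_notMem (by simpa using hx) _

theorem extendZero_of_nonneg (u : State M → M.Horizon → ℝ) (e : State M) {x : ℝ} (hx : 0 ≤ x) :
    extendZero u e x = u e (Set.projIcc 0 M.T M.T_pos.le x) :=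
  Set.indicator_of_mem (by simpa using hx) _

theorem extendZero_coe (u : State M → M.Horizon → ℝ) (e : State M) (lam : M.Horizon) :
    extendZero u e lam = u e lam := by
  rw [extendZero_of_nonneg u e lam.2.1, Set.projIcc_val]

theorem extendZero_mem_Icc (u : State M → M.Horizon → ℝ) (e : State M) {x : ℝ}
    (hx : x ∈ Set.Icc 0 M.T) : extendZero u e x = u e ⟨x, hx⟩ :=
  extendZero_coe u e ⟨x, hx⟩

theorem IsBddMeasurable.exists_abs_extendZero_le {u : State M → M.Horizon → ℝ}
    (hu : IsBddMeasurable u) : ∃ C : ℝ, 0 ≤ C ∧ ∀ e x, |extendZero u e x| ≤ C := by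
  obtain ⟨C, hC⟩ := hu.bounded
  refine ⟨|C|, abs_nonneg C, fun e x => ?_⟩
  rcases lt_or_ge x 0 with hx | hx
  · simp [extendZero_of_neg u e hx]
  · rw [extendZero_of_nonneg u e hx]
    exact (hC _ _).trans (le_abs_self C)

theorem IsBddMeasurable.measurable_extendZero {u : State M → M.Horizon → ℝ}
    (hu : IsBddMeasurable u) : Measurable fun z : State M × ℝ => extendZero u z.1 z.2 := by
  refine measurable_from_prod_countable_right fun e => ?_
  exact ((hu.measurable e).comp continuous_projIcc.measurable).indicator measurableSet_Ici

theorem isBddMeasurable_zero : IsBddMeasurable (fun (_ : State M) (_ : M.Horizon) => (0 : ℝ)) :=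
  ⟨fun _ => measurable_const, 0, by simp⟩

theorem isBddMeasurable_exp :
    IsBddMeasurable (fun (_ : State M) (lam : M.Horizon) => Real.exp lam) :=
  ⟨fun _ => by fun_prop, Real.exp M.T, fun e lam => by
    rw [abs_of_pos (Real.exp_pos _)]
    exact Real.exp_le_exp.2 lam.2.2⟩

/-! ### The one-step operator -/

section Bellman

variable (Q : SemiMarkovKernel (Feasible M) (State M)) (P : Kernel (Feasible M × M.TimeToGo) ℕ)

/-- Expectation of `u` at the next decision epoch, on the event that it precedes maturity. -/
def continuation (u : State M → M.Horizon → ℝ) (k : Feasible M) (x : ℝ) : ℝ :=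
  ∫ z, extendZero u z.2 (x - z.1) ∂Q.jumpMeasure k

/-- Expected terminal reward, on the event that there is no decision epoch before maturity. -/
def expectedTerminal (k : Feasible M) (lam : M.TimeToGo) : ℝ :=
  ∑' zz : ℕ, terminalReward k zz * (P (k, lam) {zz}).toReal

variable {Q P} {u v : State M → M.Horizon → ℝ}

theorem IsBddMeasurable.integrable_extendZero (hu : IsBddMeasurable u) (k : Feasible M) (x : ℝ) :
    Integrable (fun z : ℝ≥0 × State M => extendZero u z.2 (x - z.1)) (Q.jumpMeasure k) := by
  obtain ⟨C, -, hC⟩ := hu.exists_abs_extendZero_le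
  refine Integrable.of_bound (C := C) ?_ (ae_of_all _ fun z => hC _ _)
  exact (hu.measurable_extendZero.comp
    (measurable_snd.prodMk (by fun_prop : Measurable fun z : ℝ≥0 × State M => x - z.1)))
    |>.aestronglyMeasurable

/-- The cutoff `t ≤ λ` is absorbed by extending `u` by zero, so the sum of Stieltjes integrals is a
single integral against the joint jump law. -/
theorem bellman_eq (hu : IsBddMeasurable u) (k : Feasible M) (lam : M.Horizon) :
    bellman Q P u k lam =
      periodicReward k + expectedTerminal P k lam.toTimeToGo + continuation Q u k lam := by
  rw [bellman, expectedTerminal, continuation, Q.integral_jumpMeasure k _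
    (hu.integrable_extendZero k lam)]
  · congr 1
    refine Finset.sum_congr rfl fun e' _ => ?_
    rw [← integral_indicator (measurableSet_le (by fun_prop) measurable_const)]
    refine integral_congr_ae (ae_of_all _ fun t => ?_)
    by_cases ht : (t : ℝ) ≤ lam
    · simp [Set.indicator_of_mem, ht, extendZero_of_nonneg u e' (sub_nonneg.2 ht)]
    · simp [ht, extendZero_of_neg u e' (sub_neg.2 (not_le.1 ht))]
  · exact hu.measurable_extendZero.comp
      (measurable_snd.prodMk (by fun_prop : Measurable fun z : ℝ≥0 × State M => (lam : ℝ) - z.1))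

theorem continuation_of_neg (u : State M → M.Horizon → ℝ) (k : Feasible M) {x : ℝ} (hx : x < 0) :
    continuation Q u k x = 0 := by
  rw [continuation]
  simp only [extendZero_of_neg u _ (sub_neg.2 (hx.trans_le (NNReal.coe_nonneg _))),
    integral_zero]

theorem continuation_mono (hu : IsBddMeasurable u) (hv : IsBddMeasurable v) (h : u ≤ v)
    (k : Feasible M) (x : ℝ) : continuation Q u k x ≤ continuation Q v k x := by
  refine integral_mono (hu.integrable_extendZero k x) (hv.integrable_extendZero k x) fun z => ?_
  exact Set.indicator_le_indicator (h _ _)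

/-- After a sojourn `t` the weight becomes `e^{x-t} = e^x e^{-t}`; integrating `e^{-t}` yields the
factor `β`. Jumps past maturity contribute nothing. -/
theorem abs_continuation_sub_le {β : ℝ}
    (hβ : ∀ k, ∫ z, Real.exp (-(z.1 : ℝ)) ∂Q.jumpMeasure k ≤ β) (hu : IsBddMeasurable u)
    (hv : IsBddMeasurable v) {C : ℝ} (hC : 0 ≤ C)
    (h : ∀ e lam, |u e lam - v e lam| ≤ C * Real.exp lam) (k : Feasible M) {x : ℝ}
    (hx : x ≤ M.T) :
    |continuation Q u k x - continuation Q v k x| ≤ C * β * Real.exp x := by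
  rw [continuation, continuation,
    ← integral_sub (hu.integrable_extendZero k x) (hv.integrable_extendZero k x)]
  have hi := (Q.integrable_exp_neg_jumpMeasure k).const_mul (C * Real.exp x)
  rw [← Real.norm_eq_abs]
  refine (norm_integral_le_of_norm_le hi (ae_of_all _ fun z => ?_)).trans ?_
  · have hpos : 0 ≤ C * Real.exp x * Real.exp (-(z.1 : ℝ)) := by positivity
    rcases lt_or_ge (x - z.1) 0 with hz | hz
    · simpa [extendZero_of_neg _ _ hz] using hpos
    · have hz' : x - z.1 ∈ Set.Icc 0 M.T := ⟨hz, by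
        have := NNReal.coe_nonneg z.1
        linarith⟩
      rw [extendZero_mem_Icc _ _ hz', extendZero_mem_Icc _ _ hz', mul_assoc, ← Real.exp_add,
        ← sub_eq_add_neg]
      exact h _ _
  · rw [integral_const_mul]
    have := mul_le_mul_of_nonneg_left (hβ k) (by positivity : 0 ≤ C * Real.exp x)
    linarith

theorem measurable_continuation (hu : IsBddMeasurable u) (k : Feasible M) :
    Measurable (continuation Q u k) := by
  refine StronglyMeasurable.measurable (StronglyMeasurable.integral_prod_right (ν := Q.jumpMeasure k)
    (f := fun (x : ℝ) (z : ℝ≥0 × State M) => extendZero u z.2 (x - z.1)) ?_)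
  exact (hu.measurable_extendZero.comp ((measurable_snd.comp measurable_snd).prodMk
    (by fun_prop : Measurable fun z : ℝ × ℝ≥0 × State M => z.1 - z.2.1))).stronglyMeasurable

theorem exists_abs_continuation_le (Q : SemiMarkovKernel (Feasible M) (State M))
    (hu : IsBddMeasurable u) : ∃ C : ℝ, ∀ k x, |continuation Q u k x| ≤ C := by
  obtain ⟨C, -, hC⟩ := hu.exists_abs_extendZero_le
  refine ⟨C, fun k x => ?_⟩
  rw [continuation, ← Real.norm_eq_abs]
  refine (norm_integral_le_of_norm_le_const (C := C) (ae_of_all _ fun z => ?_)).trans ?_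
  · exact hC _ _
  · simp

/-- No more than the size of the limit order can be executed, and that size is at most `lbar`. A
finite sum makes measurability and boundedness immediate. -/
theorem expectedTerminal_eq_sum (hP : IsTerminalKernel Q P) (k : Feasible M) (lam : M.TimeToGo) :
    expectedTerminal P k lam =
      ∑ zz ∈ Finset.range (M.lbar + 1), terminalReward k zz * (P (k, lam) {zz}).toReal := by
  refine tsum_eq_sum fun zz hzz => ?_
  rw [hP.of_gt k lam zz ?_]
  · simp
  · have h1 : (k.action.l : ℕ) ≤ M.lbar := k.action.l.2.2
    simp only [Finset.mem_range, not_lt] at hzz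
    omega

theorem measurable_expectedTerminal (hP : IsTerminalKernel Q P) (k : Feasible M) :
    Measurable (expectedTerminal P k) := by
  have : expectedTerminal P k = fun lam => _ := funext fun lam => expectedTerminal_eq_sum hP k lam
  rw [this]
  refine Finset.measurable_sum _ fun zz _ => Measurable.const_mul ?_ _
  exact ((P.measurable_coe (measurableSet_singleton zz)).comp measurable_prodMk_left).ennreal_toReal

theorem measurable_bellman (hP : IsTerminalKernel Q P) (hu : IsBddMeasurable u)
    (k : Feasible M) : Measurable (bellman Q P u k) := by
  have : bellman Q P u k = fun lam => _ := funext fun lam => bellman_eq hu k lam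
  rw [this]
  refine (measurable_const.add ((measurable_expectedTerminal hP k).comp ?_)).add
    ((measurable_continuation hu k).comp measurable_subtype_coe)
  exact measurable_subtype_coe.subtype_mk

theorem exists_abs_terminalReward_le (M : Market) :
    ∃ C : ℝ, 0 ≤ C ∧ ∀ (k : Feasible M), ∀ zz ≤ M.lbar, |terminalReward k zz| ≤ C := by
  obtain ⟨C, hC⟩ := (Set.finite_range fun x : Feasible M × Fin (M.lbar + 1) =>
    |terminalReward x.1 x.2|).bddAbove
  refine ⟨|C|, abs_nonneg C, fun k zz hzz => (hC ⟨(k, ⟨zz, by omega⟩), rfl⟩).trans (le_abs_self C)⟩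

theorem exists_abs_periodicReward_le (M : Market) :
    ∃ C : ℝ, 0 ≤ C ∧ ∀ k : Feasible M, |periodicReward k| ≤ C := by
  obtain ⟨C, hC⟩ := (Set.finite_range fun k : Feasible M => |periodicReward k|).bddAbove
  exact ⟨|C|, abs_nonneg C, fun k => (hC ⟨k, rfl⟩).trans (le_abs_self C)⟩

theorem exists_abs_expectedTerminal_le (hP : IsTerminalKernel Q P) :
    ∃ C : ℝ, ∀ k lam, |expectedTerminal P k lam| ≤ C := by
  obtain ⟨C, hC0, hC⟩ := exists_abs_terminalReward_le M
  refine ⟨∑ zz ∈ Finset.range (M.lbar + 1), C, fun k lam => ?_⟩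
  rw [expectedTerminal_eq_sum hP]
  refine (Finset.abs_sum_le_sum_abs _ _).trans (Finset.sum_le_sum fun zz hzz => ?_)
  rw [abs_mul, abs_of_nonneg ENNReal.toReal_nonneg]
  refine (mul_le_mul (hC k zz (by simpa [Nat.lt_succ_iff] using hzz)) ?_
    ENNReal.toReal_nonneg hC0).trans_eq (mul_one C)
  exact ENNReal.toReal_le_of_le_ofReal zero_le_one
    (by simpa using (measure_mono (Set.subset_univ _)).trans (hP.sub_markov (k, lam)))

theorem exists_abs_bellman_le (hP : IsTerminalKernel Q P) (hu : IsBddMeasurable u) :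
    ∃ C : ℝ, ∀ k lam, |bellman Q P u k lam| ≤ C := by
  obtain ⟨C₁, -, h₁⟩ := exists_abs_periodicReward_le M
  obtain ⟨C₂, h₂⟩ := exists_abs_expectedTerminal_le hP
  obtain ⟨C₃, h₃⟩ := exists_abs_continuation_le Q hu
  refine ⟨C₁ + C₂ + C₃, fun k lam => ?_⟩
  rw [bellman_eq hu]
  exact (abs_add_three _ _ _).trans (add_le_add_three (h₁ _) (h₂ _ _) (h₃ _ _))

theorem bellman_mono (hu : IsBddMeasurable u) (hv : IsBddMeasurable v) (h : u ≤ v)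
    (k : Feasible M) (lam : M.Horizon) : bellman Q P u k lam ≤ bellman Q P v k lam := by
  rw [bellman_eq hu, bellman_eq hv]
  gcongr
  exact continuation_mono hu hv h k lam

theorem abs_bellman_sub_le {β : ℝ}
    (hβ : ∀ k, ∫ z, Real.exp (-(z.1 : ℝ)) ∂Q.jumpMeasure k ≤ β) (hu : IsBddMeasurable u)
    (hv : IsBddMeasurable v) {C : ℝ} (hC : 0 ≤ C)
    (h : ∀ e lam, |u e lam - v e lam| ≤ C * Real.exp lam) (k : Feasible M) (lam : M.Horizon) :
    |bellman Q P u k lam - bellman Q P v k lam| ≤ C * β * Real.exp lam := by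
  rw [bellman_eq hu, bellman_eq hv, add_sub_add_left_eq_sub]
  exact abs_continuation_sub_le hβ hu hv hC h k lam.2.2

end Bellman

theorem admissible_none (e : State M) : Admissible e Action.none :=
  ⟨e.vb.2.1, by simp [Action.none]⟩

instance (e : State M) : Nonempty {a : Action M // Admissible e a} :=
  ⟨⟨Action.none, admissible_none e⟩⟩

instance : Nonempty (DecisionRule M) :=
  ⟨⟨fun _ _ => Action.none, measurable_const, fun e _ => admissible_none e, fun _ _ _ => rfl⟩⟩

/-- The feasible pair chosen by a decision rule. -/
def DecisionRule.pair (φ : DecisionRule M) (e : State M) (lam : M.TimeToGo) : Feasible M :=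
  ⟨(e, φ.toFun e lam), φ.admissible e lam⟩

theorem DecisionRule.measurable_pair (φ : DecisionRule M) :
    Measurable fun x : State M × M.TimeToGo => φ.pair x.1 x.2 :=
  (measurable_fst.prodMk φ.measurable).subtype_mk

theorem measurable_toTimeToGo : Measurable (Market.Horizon.toTimeToGo (M := M)) :=
  measurable_subtype_coe.subtype_mk

section Operators

variable (Q : SemiMarkovKernel (Feasible M) (State M)) (P : Kernel (Feasible M × M.TimeToGo) ℕ)

/-! ### Operators of a decision rule and of a policy -/

/-- The one-step operator of a decision rule. -/
def policyOp (φ : DecisionRule M) (u : State M → M.Horizon → ℝ) : State M → M.Horizon → ℝ :=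
  fun e lam => bellman Q P u (φ.pair e lam.toTimeToGo) lam

/-- The composition of the operators of the first `N` decision rules of a policy. -/
def policyIter (π : Policy M) : ℕ → (State M → M.Horizon → ℝ) → State M → M.Horizon → ℝ
  | 0, u => u
  | N + 1, u => policyIter π N (policyOp Q P (π N) u)

/-- The optimality operator. -/
def optimalOp (u : State M → M.Horizon → ℝ) : State M → M.Horizon → ℝ :=
  fun e lam => ⨆ a : {a : Action M // Admissible e a}, bellman Q P u ⟨(e, a), a.2⟩ lam

variable {Q P} {u v : State M → M.Horizon → ℝ}

theorem isBddMeasurable_policyOp (hP : IsTerminalKernel Q P) (φ : DecisionRule M)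
    (hu : IsBddMeasurable u) : IsBddMeasurable (policyOp Q P φ u) := by
  constructor
  · intro e
    have h : Measurable fun x : Feasible M × M.Horizon => bellman Q P u x.1 x.2 :=
      measurable_from_prod_countable_right fun k => measurable_bellman hP hu k
    have h₁ : Measurable fun lam : M.Horizon => φ.pair e lam.toTimeToGo :=
      φ.measurable_pair.comp (measurable_prodMk_left.comp measurable_toTimeToGo)
    have h₂ : Measurable fun lam : M.Horizon => (φ.pair e lam.toTimeToGo, lam) :=
      h₁.prodMk measurable_id
    have h₃ : policyOp Q P φ u e = (fun x : Feasible M × M.Horizon => bellman Q P u x.1 x.2) ∘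
        fun lam : M.Horizon => (φ.pair e lam.toTimeToGo, lam) := by
      funext lam
      simp only [policyOp, Function.comp]
    rw [h₃]
    exact h.comp h₂
  · obtain ⟨C, hC⟩ := exists_abs_bellman_le hP hu
    exact ⟨C, fun e lam => hC _ _⟩

theorem policyOp_mono (φ : DecisionRule M) (hu : IsBddMeasurable u) (hv : IsBddMeasurable v)
    (h : u ≤ v) : policyOp Q P φ u ≤ policyOp Q P φ v :=
  fun _ _ => bellman_mono hu hv h _ _

theorem policyIter_mono (hP : IsTerminalKernel Q P) (π : Policy M) (N : ℕ)
    (hu : IsBddMeasurable u) (hv : IsBddMeasurable v)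
    (h : u ≤ v) : policyIter Q P π N u ≤ policyIter Q P π N v := by
  induction N generalizing u v with
  | zero => exact h
  | succ N ih =>
    exact ih (isBddMeasurable_policyOp hP _ hu) (isBddMeasurable_policyOp hP _ hv)
      (policyOp_mono _ hu hv h)

/-! ### The optimality operator -/

theorem bellman_le_optimalOp (u : State M → M.Horizon → ℝ) {e : State M} {a : Action M}
    (h : Admissible e a) (lam : M.Horizon) :
    bellman Q P u ⟨(e, a), h⟩ lam ≤ optimalOp Q P u e lam :=
  le_ciSup (f := fun a : {a : Action M // Admissible e a} => bellman Q P u ⟨(e, a), a.2⟩ lam)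
    (Set.finite_range _).bddAbove ⟨a, h⟩

theorem isGreatest_optimalOp (u : State M → M.Horizon → ℝ) (e : State M) (lam : M.Horizon) :
    IsGreatest {x : ℝ | ∃ (a : Action M) (h : Admissible e a),
      x = bellman Q P u ⟨(e, a), h⟩ lam} (optimalOp Q P u e lam) := by
  constructor
  · obtain ⟨a, ha⟩ := exists_eq_ciSup_of_finite
      (f := fun a : {a : Action M // Admissible e a} => bellman Q P u ⟨(e, a), a.2⟩ lam)
    exact ⟨a.1, a.2, ha.symm⟩
  · rintro x ⟨a, h, rfl⟩
    exact bellman_le_optimalOp u h lam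

theorem isBddMeasurable_optimalOp (hP : IsTerminalKernel Q P) (hu : IsBddMeasurable u) :
    IsBddMeasurable (optimalOp Q P u) := by
  constructor
  · exact fun e => Measurable.iSup fun a => measurable_bellman hP hu _
  · obtain ⟨C, hC⟩ := exists_abs_bellman_le hP hu
    refine ⟨C, fun e lam => ?_⟩
    obtain ⟨a, h, hx⟩ := (isGreatest_optimalOp (Q := Q) (P := P) u e lam).1
    rw [hx]
    exact hC _ _

/-- Taking a maximum over actions does not increase distances, so the contraction factor of the
one-step expression survives. -/
theorem abs_optimalOp_sub_le {β : ℝ}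
    (hβ : ∀ k, ∫ z, Real.exp (-(z.1 : ℝ)) ∂Q.jumpMeasure k ≤ β) (hu : IsBddMeasurable u)
    (hv : IsBddMeasurable v) {C : ℝ} (hC : 0 ≤ C)
    (h : ∀ e lam, |u e lam - v e lam| ≤ C * Real.exp lam) (e : State M) (lam : M.Horizon) :
    |optimalOp Q P u e lam - optimalOp Q P v e lam| ≤ C * β * Real.exp lam := by
  have key : ∀ {u v : State M → M.Horizon → ℝ}, IsBddMeasurable u → IsBddMeasurable v →
      (∀ e lam, |u e lam - v e lam| ≤ C * Real.exp lam) →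
      optimalOp Q P u e lam - optimalOp Q P v e lam ≤ C * β * Real.exp lam := by
    intro u v hu hv h
    rw [sub_le_iff_le_add]
    refine ciSup_le fun a => ?_
    have h1 := le_of_abs_le (abs_bellman_sub_le (P := P) hβ hu hv hC h ⟨(e, a), a.2⟩ lam)
    have h2 := bellman_le_optimalOp (Q := Q) (P := P) v a.2 lam
    linarith
  rw [abs_le']
  refine ⟨key hu hv h, ?_⟩
  rw [neg_sub]
  exact key hv hu fun e lam => by rw [abs_sub_comm]; exact h e lam

theorem IsBellmanSolution.isBddMeasurable (hu : IsBellmanSolution Q P u) : IsBddMeasurable u :=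
  ⟨hu.measurable, hu.bounded⟩

variable (Q P) in
/-- Value iteration converges to a solution of the optimality equation. -/
theorem exists_isBellmanSolution (hP : IsTerminalKernel Q P) :
    ∃ u, IsBellmanSolution Q P u := by
  obtain ⟨β, hβ0, hβ1, hβ⟩ := Q.exists_discount_integral
  let U : ℕ → State M → M.Horizon → ℝ := fun n => (optimalOp Q P)^[n] fun _ _ => 0
  have hUs : ∀ n, U (n + 1) = optimalOp Q P (U n) := fun n => Function.iterate_succ_apply' _ _ _
  have hU : ∀ n, IsBddMeasurable (U n) := by
    intro n
    induction n with
    | zero => exact isBddMeasurable_zero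
    | succ n ih => rw [hUs]; exact isBddMeasurable_optimalOp hP ih
  obtain ⟨C, hC⟩ := (hU 1).bounded
  have hC0 : 0 ≤ |C| := abs_nonneg C
  have hstep : ∀ n e lam, |U n e lam - U (n + 1) e lam| ≤ |C| * β ^ n * Real.exp lam := by
    intro n
    induction n with
    | zero =>
      intro e lam
      -- The weight is at least `1` on `[0, T]`, so a plain uniform bound is also a weighted one.
      have h1 : 1 ≤ Real.exp lam := Real.one_le_exp lam.2.1
      have h2 : |U 0 e lam - U 1 e lam| ≤ |C| := by
        have : U 0 e lam = 0 := rfl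
        rw [this, zero_sub, abs_neg]
        exact (hC e lam).trans (le_abs_self C)
      rw [pow_zero, mul_one]
      nlinarith
    | succ n ih =>
      intro e lam
      rw [hUs (n + 1), hUs n, pow_succ, ← mul_assoc]
      have := abs_optimalOp_sub_le (P := P) hβ (hU n) (hU (n + 1)) (by positivity) ih e lam
      rwa [← hUs n] at this ⊢
  have hdist : ∀ e lam n, dist (U n e lam) (U (n + 1) e lam) ≤ |C| * Real.exp lam * β ^ n := by
    intro e lam n
    rw [Real.dist_eq]
    linarith [hstep n e lam]
  choose u hu using fun e lam =>
    cauchySeq_tendsto_of_complete (cauchySeq_of_le_geometric β _ hβ1 (hdist e lam))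
  have hclose : ∀ n e lam, |U n e lam - u e lam| ≤ |C| * β ^ n / (1 - β) * Real.exp lam := by
    intro n e lam
    have := dist_le_of_le_geometric_of_tendsto β _ hβ1 (hdist e lam) (hu e lam) n
    rw [Real.dist_eq] at this
    refine this.trans_eq ?_
    ring
  have hu' : IsBddMeasurable u := by
    refine ⟨fun e => measurable_of_tendsto_metrizable (fun n => (hU n).measurable e)
      (tendsto_pi_nhds.2 (hu e)), |C| * β ^ 0 / (1 - β) * Real.exp M.T, fun e lam => ?_⟩
    have h1 := hclose 0 e lam
    have : U 0 e lam = 0 := rfl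
    rw [this, zero_sub, abs_neg] at h1
    refine h1.trans ?_
    have : 0 < 1 - β := sub_pos.2 hβ1
    gcongr
    exact lam.2.2
  have hfix : optimalOp Q P u = u := by
    funext e lam
    refine tendsto_nhds_unique ?_ (hu e lam)
    -- The shifted iterates are images of the iterates under `optimalOp`, and by contraction they
    -- also converge to `optimalOp Q P u`.
    rw [← Filter.tendsto_add_atTop_iff_nat 1]
    have hlim : Filter.Tendsto (fun n : ℕ => |C| * β ^ n / (1 - β) * β * Real.exp lam)
        Filter.atTop (𝓝 (|C| * 0 / (1 - β) * β * Real.exp lam)) :=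
      ((((tendsto_pow_atTop_nhds_zero_of_lt_one hβ0 hβ1).const_mul _).div_const _).mul_const
        _).mul_const _
    rw [tendsto_iff_dist_tendsto_zero]
    refine squeeze_zero (fun _ => dist_nonneg) (fun n => ?_) (by simpa using hlim)
    rw [hUs, Real.dist_eq]
    have : 0 < 1 - β := sub_pos.2 hβ1
    exact abs_optimalOp_sub_le hβ (hU n) hu' (by positivity) (hclose n) e lam
  refine ⟨u, hu'.measurable, hu'.bounded, fun e lam => ?_⟩
  have := isGreatest_optimalOp (Q := Q) (P := P) u e lam
  rwa [hfix] at this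

theorem IsBellmanSolution.policyOp_le (hu : IsBellmanSolution Q P u) (φ : DecisionRule M) :
    policyOp Q P φ u ≤ u :=
  fun e lam => (hu.eq_max e lam).2 ⟨_, _, rfl⟩

theorem IsBellmanSolution.policyIter_le (hP : IsTerminalKernel Q P)
    (hu : IsBellmanSolution Q P u) (π : Policy M) (N : ℕ) : policyIter Q P π N u ≤ u := by
  induction N with
  | zero => exact le_rfl
  | succ N ih =>
    exact (policyIter_mono hP π N (isBddMeasurable_policyOp hP _ hu.isBddMeasurable)
      hu.isBddMeasurable (hu.policyOp_le _)).trans ih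

theorem policyIter_stationary_of_fixed {φ : DecisionRule M} (h : policyOp Q P φ u = u) (N : ℕ) :
    policyIter Q P (stationary φ) N u = u := by
  induction N with
  | zero => rfl
  | succ N ih => rw [policyIter, stationary, h]; exact ih

/-- A maximising action can be selected measurably. -/
theorem exists_maximising_decisionRule (hP : IsTerminalKernel Q P) (hu : IsBddMeasurable u) :
    ∃ φ : DecisionRule M, ∀ (e : State M) (lam : M.Horizon) (a : Action M) (h : Admissible e a),
      bellman Q P u ⟨(e, a), h⟩ lam ≤ policyOp Q P φ u e lam := by
  classical
  let proj : M.TimeToGo → M.Horizon := fun x => Set.projIcc 0 M.T M.T_pos.le x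
  have hproj : Measurable proj := continuous_projIcc.measurable.comp measurable_subtype_coe
  let n := Fintype.equivFin (Action M)
  -- Ties are broken by taking the least index in an enumeration of the actions; `Nat.find` over
  -- measurable conditions is measurable. The two implications impose `(0, 0)` after maturity and
  -- maximality before it.
  let p : M.TimeToGo → State M → ℕ → Prop := fun x e i =>
    ∃ (a : Action M) (h : Admissible e a), (n a : ℕ) = i ∧
      ((x : ℝ) < 0 → a = Action.none) ∧
        (0 ≤ (x : ℝ) → optimalOp Q P u e (proj x) ≤ bellman Q P u ⟨(e, a), h⟩ (proj x))
  have hp : ∀ z : State M × M.TimeToGo, ∃ i, p z.2 z.1 i := by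
    rintro ⟨e, x⟩
    by_cases hx : (x : ℝ) < 0
    · exact ⟨_, Action.none, admissible_none e, rfl, fun _ => rfl, fun h => absurd hx (not_lt.2 h)⟩
    · obtain ⟨a, h, ha⟩ := (isGreatest_optimalOp (Q := Q) (P := P) u e (proj x)).1
      exact ⟨_, a, h, rfl, fun h => absurd h hx, fun _ => ha.le⟩
  have hmeas : Measurable fun z : State M × M.TimeToGo => Nat.find (hp z) := by
    refine measurable_find hp fun i => ?_
    have : ∀ e, Measurable fun x : M.TimeToGo => p x e i := by
      intro e
      refine Measurable.exists fun a => Measurable.exists fun h => Measurable.and measurable_const ?_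
      have hneg : MeasurableSet {x : M.TimeToGo | (x : ℝ) < 0} :=
        measurableSet_lt measurable_subtype_coe measurable_const
      have hnn : MeasurableSet {x : M.TimeToGo | 0 ≤ (x : ℝ)} :=
        measurableSet_le measurable_const measurable_subtype_coe
      have hle : MeasurableSet {x : M.TimeToGo | optimalOp Q P u e (proj x) ≤
          bellman Q P u ⟨(e, a), h⟩ (proj x)} :=
        measurableSet_le (((isBddMeasurable_optimalOp hP hu).measurable e).comp hproj)
          ((measurable_bellman hP hu _).comp hproj)
      exact ((measurableSet_setOfPred.1 hneg).imp measurable_const).and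
        ((measurableSet_setOfPred.1 hnn).imp (measurableSet_setOfPred.1 hle))
    exact (measurable_from_prod_countable_right this :
      Measurable fun z : State M × M.TimeToGo => p z.2 z.1 i).setOf
  let f : State M → M.TimeToGo → Action M := fun e x => (Nat.find_spec (hp (e, x))).choose
  have hf : ∀ e x, ∃ h : Admissible e (f e x), (n (f e x) : ℕ) = Nat.find (hp (e, x)) ∧
      ((x : ℝ) < 0 → f e x = Action.none) ∧
        (0 ≤ (x : ℝ) → optimalOp Q P u e (proj x) ≤ bellman Q P u ⟨(e, f e x), h⟩ (proj x)) :=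
    fun e x => (Nat.find_spec (hp (e, x))).choose_spec
  have hfm : Measurable fun z : State M × M.TimeToGo => f z.1 z.2 := by
    refine measurable_to_countable' fun a => ?_
    have : (fun z : State M × M.TimeToGo => f z.1 z.2) ⁻¹' {a} =
        (fun z => Nat.find (hp z)) ⁻¹' {(n a : ℕ)} := by
      ext z
      have h := (hf z.1 z.2).choose_spec.1
      simp only [Set.mem_preimage, Set.mem_singleton_iff]
      change _ ↔ Nat.find (hp (z.1, z.2)) = _
      rw [← h, Fin.val_inj, n.injective.eq_iff]
    rw [this]
    exact hmeas (measurableSet_singleton _)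
  refine ⟨⟨f, hfm, fun e x => (hf e x).choose, fun e x hx => ?_⟩, fun e lam a h => ?_⟩
  · exact (hf e x).choose_spec.2.1 hx
  · obtain ⟨h', -, -, hle⟩ := hf e lam.toTimeToGo
    have hlam : proj lam.toTimeToGo = lam := Set.projIcc_val M.T_pos.le lam
    rw [hlam] at hle
    exact (bellman_le_optimalOp u h lam).trans (hle lam.2.1)

theorem IsBellmanSolution.policyOp_eq (hu : IsBellmanSolution Q P u) {φ : DecisionRule M}
    (h : ∀ (e : State M) (lam : M.Horizon) (a : Action M) (h : Admissible e a),
      bellman Q P u ⟨(e, a), h⟩ lam ≤ policyOp Q P φ u e lam) : policyOp Q P φ u = u := by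
  refine le_antisymm (hu.policyOp_le φ) fun e lam => ?_
  obtain ⟨a, ha, hx⟩ := (hu.eq_max e lam).1
  rw [hx]
  exact h e lam a ha

end Operators

/-! ### Conditional probabilities -/

/-- The defining property of conditional expectation, moved to `ℝ≥0∞` so that it can be compared
with kernels. The converse is `condExp_eq_of_measure_inter`. -/
theorem measure_inter_eq_setLIntegral_of_condExp {Ω : Type*} {m m₀ : MeasurableSpace Ω}
    {μ : Measure Ω} [IsFiniteMeasure μ] (hm : m ≤ m₀) {s B : Set Ω} (hs : MeasurableSet[m] s)
    (hB : MeasurableSet B) {f : Ω → ℝ≥0∞} (hf : Measurable f) (hf1 : ∀ ω, f ω ≤ 1)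
    (h : μ⟦B | m⟧ =ᵐ[μ] fun ω => (f ω).toReal) : μ (s ∩ B) = ∫⁻ ω in s, f ω ∂μ := by
  have hlt : ∫⁻ ω in s, f ω ∂μ ≠ ⊤ := by
    refine ((lintegral_mono (g := fun _ => 1) hf1).trans_lt ?_).ne
    simp
  rw [← ENNReal.toReal_eq_toReal_iff' (by finiteness) hlt,
    ← integral_toReal hf.aemeasurable (ae_of_all _ fun ω => (hf1 ω).trans_lt ENNReal.one_lt_top),
    ← setIntegral_congr_ae (hm s hs) (h.mono fun ω hω _ => hω),
    setIntegral_condExp hm ((integrable_const _).indicator hB) hs,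
    setIntegral_indicator hB]
  simp [Measure.real]

theorem integral_mul_eq_of_condExp {Ω : Type*} {m m₀ : MeasurableSpace Ω}
    {μ : Measure Ω} [IsFiniteMeasure μ] (hm : m ≤ m₀) {f g g' : Ω → ℝ}
    (hf : StronglyMeasurable[m] f) {C : ℝ} (hC : ∀ ω, |f ω| ≤ C) (hg : Integrable g μ)
    (h : μ[g | m] =ᵐ[μ] g') : ∫ ω, f ω * g ω ∂μ = ∫ ω, f ω * g' ω ∂μ := by
  have h1 := condExp_stronglyMeasurable_mul_of_bound hm hf hg C (ae_of_all _ hC)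
  have h2 : ∫ ω, f ω * g ω ∂μ = ∫ ω, (μ[f * g | m]) ω ∂μ := (integral_condExp hm).symm
  rw [h2]
  refine integral_congr_ae (h1.trans ?_)
  filter_upwards [h] with ω hω
  rw [Pi.mul_apply, hω]

/-- The second factor is countable, so a measure splits into slices over its points, and a finite
measure on `ℝ≥0` is determined by its distribution function. -/
theorem measure_ext_of_Iic_prod {Ω₂ : Type*} [MeasurableSpace Ω₂] [Countable Ω₂]
    [MeasurableSingletonClass Ω₂] {ν₁ ν₂ : Measure (ℝ≥0 × Ω₂)} [IsFiniteMeasure ν₁]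
    (h : ∀ (t : ℝ≥0) (x : Ω₂), ν₁ (Set.Iic t ×ˢ {x}) = ν₂ (Set.Iic t ×ˢ {x})) : ν₁ = ν₂ := by
  have h1 : ∀ {s : Set ℝ≥0}, MeasurableSet s → ∀ x, ν₁ (s ×ˢ {x}) = ν₂ (s ×ˢ {x}) := by
    intro s hs x
    have hx : MeasurableSet (Set.univ ×ˢ {x} : Set (ℝ≥0 × Ω₂)) :=
      MeasurableSet.univ.prod (measurableSet_singleton x)
    have happ : ∀ (ν : Measure (ℝ≥0 × Ω₂)) {s : Set ℝ≥0}, MeasurableSet s →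
        (ν.restrict (Set.univ ×ˢ {x})).map Prod.fst s = ν (s ×ˢ {x}) := by
      intro ν s hs
      rw [Measure.map_apply measurable_fst hs, Measure.restrict_apply (measurable_fst hs)]
      congr 1
      ext z
      simp
    rw [← happ ν₁ hs, ← happ ν₂ hs,
      Measure.ext_of_Iic ((ν₁.restrict (Set.univ ×ˢ {x})).map Prod.fst)
        ((ν₂.restrict (Set.univ ×ˢ {x})).map Prod.fst) fun t => ?_]
    rw [happ _ measurableSet_Iic, happ _ measurableSet_Iic, h]
  refine Measure.ext_prod fun {s t} hs ht => ?_
  have hst : s ×ˢ t = ⋃ x ∈ t, s ×ˢ ({x} : Set Ω₂) := by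
    ext z
    simp [and_comm]
  have hd : t.PairwiseDisjoint fun x => s ×ˢ ({x} : Set Ω₂) := by
    intro x _ y _ hxy
    rw [Function.onFun, Set.disjoint_left]
    rintro z ⟨-, hz⟩ ⟨-, hz'⟩
    exact hxy (hz.symm.trans hz')
  rw [hst, measure_biUnion t.to_countable hd fun x _ => hs.prod (measurableSet_singleton x),
    measure_biUnion t.to_countable hd fun x _ => hs.prod (measurableSet_singleton x)]
  exact tsum_congr fun x => h1 hs x

/-! ### Measurability of the coordinates and of the histories -/

namespace Path

@[fun_prop]
theorem measurable_X (n : ℕ) : Measurable (X (M := M) n) := by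
  unfold X; fun_prop

@[fun_prop]
theorem measurable_pair (n : ℕ) : Measurable (pair (M := M) n) := by
  unfold pair; fun_prop

@[fun_prop]
theorem measurable_Lam (n : ℕ) : Measurable (Lam (M := M) n) := by
  unfold Lam; fun_prop

theorem measurable_lastIndex : Measurable (lastIndex (M := M)) := measurable_fst

theorem measurable_executed : Measurable (executed (M := M)) :=
  measurable_fst.comp measurable_snd

@[fun_prop]
theorem measurable_E (n : ℕ) : Measurable (E (M := M) n) :=
  (Measurable.of_discrete (f := Feasible.state (M := M))).comp (measurable_pair n)

@[fun_prop]
theorem measurable_A (n : ℕ) : Measurable (A (M := M) n) :=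
  (Measurable.of_discrete (f := Feasible.action (M := M))).comp (measurable_pair n)

theorem measurable_hist (n : ℕ) : Measurable (hist (M := M) n) := by
  unfold hist; fun_prop

theorem histSigma_le (n : ℕ) : histSigma M n ≤ (inferInstance : MeasurableSpace (Path M)) :=
  (measurable_hist n).comap_le

theorem histActSigma_le (n : ℕ) : histActSigma M n ≤ (inferInstance : MeasurableSpace (Path M)) :=
  ((measurable_hist n).prodMk (measurable_A n)).comap_le

theorem measurable_pair_Lam_histActSigma (n : ℕ) :
    Measurable[histActSigma M n] fun ω : Path M => (pair n ω, Lam n ω) := by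
  let := histActSigma M n
  have h : Measurable fun ω : Path M => (hist n ω, A n ω) := comap_measurable _
  have h2 : Measurable fun ω : Path M => (hist n ω).2.2 := h.fst.snd.snd
  have hE : Measurable fun ω : Path M => (hist n ω).2.2.1 := h2.fst
  have hL : Measurable fun ω : Path M => (hist n ω).2.2.2 := h2.snd
  have hA : Measurable fun ω : Path M => A n ω := h.snd
  have hp : Measurable fun ω : Path M => pair n ω :=
    Measurable.subtype_mk (f := fun ω : Path M => (E n ω, A n ω)) (hE.prodMk hA)
      (h := fun ω => (pair n ω).2)
  exact hp.prodMk hL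

theorem measurable_E_Lam_histSigma (n : ℕ) :
    Measurable[histSigma M n] fun ω : Path M => (E n ω, Lam n ω) := by
  let := histSigma M n
  have h : Measurable fun ω : Path M => hist n ω := comap_measurable _
  exact measurable_snd.comp (measurable_snd.comp h)

end Path

open Liquidation.Path

/-! ### The law of a jump under the transition condition -/

section Transition

variable {Q : SemiMarkovKernel (Feasible M) (State M)} {μ : Measure (Path M)}
  {u : State M → M.Horizon → ℝ}

/-- The transition condition only concerns the sets `Iic t ×ˢ {e'}`. On each event fixing `(pair n,
Lam n)` in a set `s`, these determine the whole distribution of the next jump, which gives the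
composition-product. Only the transition condition is assumed, so the result is available before a
measure is known to be a law. -/
theorem map_jump_of_transition [IsProbabilityMeasure μ] {n : ℕ}
    (ht : ∀ (t : ℝ≥0) (e' : State M),
      μ⟦{ω | X (n + 1) ω ≤ t ∧ E (n + 1) ω = e'} | histActSigma M n⟧ =ᵐ[μ]
        fun ω => (Q.kernel t (pair n ω) {e'}).toReal) :
    μ.map (fun ω => ((pair n ω, Lam n ω), (X (n + 1) ω, E (n + 1) ω))) =
      (μ.map fun ω => (pair n ω, Lam n ω)) ⊗ₘ (Q.jumpKernel.comap Prod.fst measurable_fst) := by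
  have hY : Measurable fun ω : Path M => (pair n ω, Lam n ω) :=
    (measurable_pair n).prodMk (measurable_Lam n)
  have hZ : Measurable fun ω : Path M => (X (n + 1) ω, E (n + 1) ω) :=
    (measurable_X _).prodMk (measurable_E _)
  have : IsProbabilityMeasure (μ.map fun ω => (pair n ω, Lam n ω)) :=
    Measure.isProbabilityMeasure_map hY.aemeasurable
  have := Measure.isFiniteMeasure_map μ
    (fun ω => ((pair n ω, Lam n ω), (X (n + 1) ω, E (n + 1) ω)))
  refine Measure.ext_prod fun {s s'} hs hs' => ?_
  set κ := Q.jumpKernel.comap (Prod.fst : Feasible M × M.TimeToGo → Feasible M) measurable_fst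
  have key : (μ.restrict ((fun ω => (pair n ω, Lam n ω)) ⁻¹' s)).map
      (fun ω => (X (n + 1) ω, E (n + 1) ω)) =
      ((μ.map fun ω => (pair n ω, Lam n ω)).restrict s).bind κ := by
    refine measure_ext_of_Iic_prod fun x e' => ?_
    have hm : MeasurableSet (Set.Iic x ×ˢ {e'} : Set (ℝ≥0 × State M)) :=
      measurableSet_Iic.prod (measurableSet_singleton e')
    have hf : Measurable fun k : Feasible M => Q.kernel x k {e'} := Measurable.of_discrete
    have h1 := measure_inter_eq_setLIntegral_of_condExp (histActSigma_le n)
      (measurable_pair_Lam_histActSigma n hs) (hZ hm)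
      (hf.comp (measurable_pair n))
      (fun ω => (measure_mono (Set.subset_univ _)).trans (Q.sub_markov x (pair n ω)))
      (ht x e')
    rw [Measure.map_apply hZ hm, Measure.restrict_apply (hZ hm), Set.inter_comm, h1,
      Measure.bind_apply hm κ.aemeasurable, ← lintegral_indicator hs,
      lintegral_map ((κ.measurable_coe hm).indicator hs) hY, ← lintegral_indicator (hY hs)]
    refine lintegral_congr fun ω => ?_
    simp only [Set.indicator, Set.mem_preimage, κ, Kernel.comap_apply, Q.jumpKernel_apply,
      Q.jumpMeasure_Iic_prod, Function.comp]
    rfl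
  rw [Measure.map_apply (hY.prodMk hZ) (hs.prod hs'), Measure.compProd_apply_prod hs hs',
    ← Measure.bind_apply hs' κ.aemeasurable, ← key, Measure.map_apply hZ hs',
    Measure.restrict_apply (hZ hs'), Set.inter_comm]
  rfl

theorem integral_extendZero_succ_of_transition [IsProbabilityMeasure μ] {n : ℕ}
    (ht : ∀ (t : ℝ≥0) (e' : State M),
      μ⟦{ω | X (n + 1) ω ≤ t ∧ E (n + 1) ω = e'} | histActSigma M n⟧ =ᵐ[μ]
        fun ω => (Q.kernel t (pair n ω) {e'}).toReal)
    (hstep : ∀ᵐ ω ∂μ, (Lam (n + 1) ω : ℝ) = Lam n ω - X (n + 1) ω) (hu : IsBddMeasurable u) :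
    ∫ ω, extendZero u (E (n + 1) ω) (Lam (n + 1) ω) ∂μ =
      ∫ ω, continuation Q u (pair n ω) (Lam n ω) ∂μ := by
  have hY : Measurable fun ω : Path M => (pair n ω, Lam n ω) :=
    (measurable_pair n).prodMk (measurable_Lam n)
  have hZ : Measurable fun ω : Path M => (X (n + 1) ω, E (n + 1) ω) :=
    (measurable_X _).prodMk (measurable_E _)
  have : IsProbabilityMeasure (μ.map fun ω => (pair n ω, Lam n ω)) :=
    Measure.isProbabilityMeasure_map hY.aemeasurable
  let F : (Feasible M × M.TimeToGo) × ℝ≥0 × State M → ℝ :=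
    fun z => extendZero u z.2.2 (z.1.2 - z.2.1)
  have hF : Measurable F := by
    refine hu.measurable_extendZero.comp ((measurable_snd.comp measurable_snd).prodMk ?_)
    exact (measurable_subtype_coe.comp (measurable_snd.comp measurable_fst)).sub
      (measurable_subtype_coe.comp (measurable_fst.comp measurable_snd))
  obtain ⟨C, -, hC⟩ := hu.exists_abs_extendZero_le
  have h1 : ∫ ω, extendZero u (E (n + 1) ω) (Lam (n + 1) ω) ∂μ =
      ∫ ω, F ((pair n ω, Lam n ω), (X (n + 1) ω, E (n + 1) ω)) ∂μ := by
    refine integral_congr_ae ?_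
    filter_upwards [hstep] with ω hω
    simp only [F, hω]
  rw [h1, ← integral_map (f := F) (hY.prodMk hZ).aemeasurable hF.aestronglyMeasurable, map_jump_of_transition ht,
    Measure.integral_compProd (Integrable.of_bound (C := C) hF.aestronglyMeasurable
      (ae_of_all _ fun z => hC _ _)), integral_map hY.aemeasurable]
  · rfl
  · exact (hF.stronglyMeasurable.integral_kernel_prod_right
      (f := fun x y => F (x, y))).aestronglyMeasurable

end Transition

/-! ### Almost sure consequences of the conditional laws -/

namespace IsLaw

variable {Q : SemiMarkovKernel (Feasible M) (State M)} {P : Kernel (Feasible M × M.TimeToGo) ℕ}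
  {π : Policy M} {e : State M} {lam : M.Horizon} {μ : Measure (Path M)}
  {u : State M → M.Horizon → ℝ}

/-- On the event that the rule prescribes `a`, the conditional probability of `A n = a` is one, so
the two events differ there by a null set. Finitely many actions suffice. -/
theorem ae_action (h : IsLaw Q P π e lam μ) (n : ℕ) :
    ∀ᵐ ω ∂μ, pair n ω = (π n).pair (E n ω) (Lam n ω) := by
  have := h.prob
  have key : ∀ a : Action M, ∀ᵐ ω ∂μ, (π n).toFun (E n ω) (Lam n ω) = a → A n ω = a := by
    intro a
    set s : Set (Path M) := {ω | (π n).toFun (E n ω) (Lam n ω) = a}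
    have hs : MeasurableSet[histSigma M n] s :=
      ((π n).measurable.comp (measurable_E_Lam_histSigma n)) (measurableSet_singleton a)
    have hB : MeasurableSet {ω : Path M | A n ω = a} := measurable_A n (measurableSet_singleton a)
    have h1 := measure_inter_eq_setLIntegral_of_condExp (histSigma_le n) hs hB
      (f := s.indicator fun _ => 1) (measurable_const.indicator (histSigma_le n s hs))
      (fun ω => Set.indicator_le_self' (fun _ _ => zero_le_one) ω)
      ((h.action n a).trans (ae_of_all _ fun ω => by
        by_cases hω : ω ∈ s
        · simp only [Set.indicator_of_mem hω, ENNReal.toReal_one]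
          exact Set.indicator_of_mem hω _
        · simp only [Set.indicator_of_notMem hω, ENNReal.toReal_zero]
          exact Set.indicator_of_notMem hω _))
    rw [lintegral_indicator (histSigma_le n s hs), Measure.restrict_restrict (histSigma_le n s hs),
      Set.inter_self, lintegral_one, Measure.restrict_apply_univ] at h1
    have h2 : μ (s \ {ω : Path M | A n ω = a}) = 0 := by
      rw [← Set.sdiff_self_inter, measure_sdiff Set.inter_subset_left
        ((histSigma_le n s hs).inter hB).nullMeasurableSet (by finiteness), h1, tsub_self]
    rw [ae_iff]
    convert h2 using 2
    ext ω
    simp [s]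
  filter_upwards [ae_all_iff.2 key] with ω hω
  exact Subtype.ext (Prod.ext rfl (hω _ rfl))

theorem integral_extendZero_succ (h : IsLaw Q P π e lam μ) (hu : IsBddMeasurable u) (n : ℕ) :
    ∫ ω, extendZero u (E (n + 1) ω) (Lam (n + 1) ω) ∂μ =
      ∫ ω, continuation Q u (pair n ω) (Lam n ω) ∂μ :=
  have := h.prob
  integral_extendZero_succ_of_transition (h.transition n) (h.time_step n) hu

end IsLaw

/-! ### Decomposition of the reward by epochs -/

namespace Path

/-- Times at which the process is still before maturity. -/
def alive (n : ℕ) : Set (Path M) := {ω | 0 ≤ (Lam n ω : ℝ)}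

/-- The event that epoch `n` is the last one before maturity and `zz` units are then executed. -/
def lastExecuted (n zz : ℕ) : Set (Path M) :=
  {ω | 0 ≤ (Lam n ω : ℝ) ∧ (Lam n ω : ℝ) < X (n + 1) ω ∧ executed ω = zz}

/-- The reward collected at epoch `n`. -/
def stageReward (n : ℕ) (ω : Path M) : ℝ :=
  (alive n).indicator (fun ω => periodicReward (pair n ω)) ω +
    (alive n ∩ {ω | (Lam n ω : ℝ) < X (n + 1) ω}).indicator
      (fun ω => terminalReward (pair n ω) (executed ω)) ω

theorem measurableSet_alive (n : ℕ) : MeasurableSet (alive (M := M) n) :=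
  measurableSet_le measurable_const (measurable_subtype_coe.comp (measurable_Lam n))

theorem measurableSet_last (n : ℕ) : MeasurableSet {ω : Path M | (Lam n ω : ℝ) < X (n + 1) ω} :=
  measurableSet_lt (measurable_subtype_coe.comp (measurable_Lam n))
    (measurable_subtype_coe.comp (measurable_X _))

theorem measurableSet_lastExecuted (n zz : ℕ) : MeasurableSet (lastExecuted (M := M) n zz) :=
  (measurableSet_alive n).inter ((measurableSet_last n).inter
    (measurable_executed (measurableSet_singleton zz)))

theorem measurable_pair_executed (n : ℕ) (g : Feasible M → ℕ → ℝ) :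
    Measurable fun ω : Path M => g (pair n ω) (executed ω) := by
  have h : Measurable (Function.uncurry g) := Measurable.of_discrete
  exact h.comp ((measurable_pair n).prodMk measurable_executed)

theorem measurable_terminalReward_executed (n : ℕ) :
    Measurable fun ω : Path M => terminalReward (pair n ω) (executed ω) :=
  measurable_pair_executed n terminalReward

theorem measurable_periodicReward_pair (n : ℕ) :
    Measurable fun ω : Path M => periodicReward (pair n ω) :=
  (Measurable.of_discrete (f := periodicReward (M := M))).comp (measurable_pair n)

theorem measurable_stageReward (n : ℕ) : Measurable (stageReward (M := M) n) :=
  ((measurable_periodicReward_pair n).indicator (measurableSet_alive n)).add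
    ((measurable_terminalReward_executed n).indicator
      ((measurableSet_alive n).inter (measurableSet_last n)))

end Path

/-! ### The one-step identity and its telescoped form -/

namespace IsLaw

variable {Q : SemiMarkovKernel (Feasible M) (State M)} {P : Kernel (Feasible M × M.TimeToGo) ℕ}
  {π : Policy M} {e : State M} {lam : M.Horizon} {μ : Measure (Path M)}
  {u : State M → M.Horizon → ℝ}

theorem ae_executed_le (hP : IsTerminalKernel Q P) (h : IsLaw Q P π e lam μ) (n : ℕ) :
    ∀ᵐ ω ∂μ, ω ∈ alive n → (Lam n ω : ℝ) < X (n + 1) ω → executed ω ≤ M.lbar := by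
  have := h.prob
  have key : ∀ zz, M.lbar < zz → ∀ᵐ ω ∂μ, ω ∉ lastExecuted n zz := by
    intro zz hzz
    have h1 := measure_inter_eq_setLIntegral_of_condExp (histActSigma_le n) MeasurableSet.univ
      (measurableSet_lastExecuted n zz) (f := 0) measurable_const (fun _ => zero_le_one)
      ((h.terminal n zz).trans (ae_of_all _ fun ω => by
        have hk : ((pair n ω).action.l : ℕ) ≤ M.lbar := (pair n ω).action.l.2.2
        simp [hP.of_gt (pair n ω) (Lam n ω) zz (hk.trans_lt hzz)]))
    rw [Set.univ_inter] at h1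
    simpa [ae_iff] using h1
  filter_upwards [ae_all_iff.2 fun i => key (M.lbar + 1 + i) (by omega)] with ω hω h1 h2
  by_contra! hlt
  obtain ⟨i, hi⟩ := Nat.exists_eq_add_of_le (Nat.succ_le_of_lt hlt)
  exact hω i ⟨h1, h2, hi⟩

/-- The reward is split over the finitely many possible executed volumes. For each of them the
factor `terminalReward (pair n ω) zz` is known given the history and action, so the indicator may be
replaced by its conditional probability. -/
theorem integral_terminal (hP : IsTerminalKernel Q P) (h : IsLaw Q P π e lam μ) (n : ℕ) :
    ∫ ω, (alive n ∩ {ω | (Lam n ω : ℝ) < X (n + 1) ω}).indicator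
      (fun ω => terminalReward (pair n ω) (executed ω)) ω ∂μ =
      ∫ ω, (alive n).indicator (fun ω => expectedTerminal P (pair n ω) (Lam n ω)) ω ∂μ := by
  have := h.prob
  obtain ⟨C, hC0, hC⟩ := exists_abs_terminalReward_le M
  have hzz : ∀ zz ∈ Finset.range (M.lbar + 1), ∀ k : Feasible M, |terminalReward k zz| ≤ C :=
    fun zz hzz k => hC k zz (by simpa [Nat.lt_succ_iff] using hzz)
  have hwm : ∀ zz, StronglyMeasurable[histActSigma M n] fun ω : Path M =>
      terminalReward (pair n ω) zz := by
    intro zz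
    have h1 := (measurable_pair_Lam_histActSigma (M := M) n).fst
    exact ((Measurable.of_discrete (f := fun k : Feasible M => terminalReward k zz)).comp
      h1).stronglyMeasurable
  have hi : ∀ zz, Integrable ((lastExecuted (M := M) n zz).indicator fun _ => (1 : ℝ)) μ :=
    fun zz => (integrable_const _).indicator (measurableSet_lastExecuted n zz)
  have hPi : ∀ zz, Integrable ((alive n).indicator
      fun ω : Path M => (P (pair n ω, Lam n ω) {zz}).toReal) μ := by
    intro zz
    exact integrable_condExp.congr (h.terminal n zz)
  have hbd : ∀ zz ∈ Finset.range (M.lbar + 1), ∀ {f : Path M → ℝ}, Integrable f μ →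
      Integrable (fun ω => terminalReward (pair n ω) zz * f ω) μ := by
    intro zz h0 f hf
    exact hf.bdd_mul (c := C) ((hwm zz).mono (histActSigma_le n)).aestronglyMeasurable
      (ae_of_all _ fun ω => hzz zz h0 _)
  have h1 : ∀ᵐ ω ∂μ, (alive n ∩ {ω | (Lam n ω : ℝ) < X (n + 1) ω}).indicator
      (fun ω => terminalReward (pair n ω) (executed ω)) ω =
      ∑ zz ∈ Finset.range (M.lbar + 1), terminalReward (pair n ω) zz *
        (lastExecuted n zz).indicator (fun _ => (1 : ℝ)) ω := by
    filter_upwards [h.ae_executed_le hP n] with ω hω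
    by_cases hB : ω ∈ alive n ∩ {ω | (Lam n ω : ℝ) < X (n + 1) ω}
    · rw [Set.indicator_of_mem hB, Finset.sum_eq_single (executed ω)]
      · rw [Set.indicator_of_mem (show ω ∈ lastExecuted n (executed ω) from ⟨hB.1, hB.2, rfl⟩),
          mul_one]
      · intro zz _ hne
        rw [Set.indicator_of_notMem (fun h => hne h.2.2.symm), mul_zero]
      · intro hn
        exact absurd (Finset.mem_range.2 (Nat.lt_succ_of_le (hω hB.1 hB.2))) hn
    · rw [Set.indicator_of_notMem hB, Finset.sum_eq_zero]
      intro zz _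
      rw [Set.indicator_of_notMem (fun h => hB ⟨h.1, h.2.1⟩), mul_zero]
  rw [integral_congr_ae h1, integral_finsetSum _ fun zz h0 => hbd zz h0 (hi zz)]
  have h2 : ∀ ω, (alive n).indicator (fun ω => expectedTerminal P (pair n ω) (Lam n ω)) ω =
      ∑ zz ∈ Finset.range (M.lbar + 1), terminalReward (pair n ω) zz *
        (alive n).indicator (fun ω : Path M => (P (pair n ω, Lam n ω) {zz}).toReal) ω := by
    intro ω
    by_cases hω : ω ∈ alive n
    · simp only [Set.indicator_of_mem hω, expectedTerminal_eq_sum hP]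
    · simp only [Set.indicator_of_notMem hω, mul_zero, Finset.sum_const_zero]
  rw [integral_congr_ae (ae_of_all _ h2), integral_finsetSum _ fun zz h0 => hbd zz h0 (hPi zz)]
  exact Finset.sum_congr rfl fun zz h0 => integral_mul_eq_of_condExp (histActSigma_le n)
    (hwm zz) (fun ω => hzz zz h0 _) (hi zz) (h.terminal n zz)

/-- Conditioning on history and action turns the left side into the three terms of the one-step
expression at the pair chosen by `π n`. At epochs after maturity both sides vanish, owing to the
extension by zero. -/
theorem integral_stageReward_add (hP : IsTerminalKernel Q P) (h : IsLaw Q P π e lam μ)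
    (hu : IsBddMeasurable u) (n : ℕ) :
    ∫ ω, stageReward n ω ∂μ + ∫ ω, extendZero u (E (n + 1) ω) (Lam (n + 1) ω) ∂μ =
      ∫ ω, extendZero (policyOp Q P (π n) u) (E n ω) (Lam n ω) ∂μ := by
  have := h.prob
  obtain ⟨C₁, -, h₁⟩ := exists_abs_periodicReward_le M
  obtain ⟨C₂, h₂⟩ := exists_abs_expectedTerminal_le hP
  obtain ⟨C₃, h₃⟩ := exists_abs_continuation_le Q hu
  obtain ⟨C₄, hC₄, h₄⟩ := exists_abs_terminalReward_le M
  have i₁ : Integrable ((alive n).indicator fun ω : Path M => periodicReward (pair n ω)) μ :=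
    (Integrable.of_bound (C := C₁) (measurable_periodicReward_pair n).aestronglyMeasurable
      (ae_of_all _ fun ω => h₁ _)).indicator (measurableSet_alive n)
  have i₂ : Integrable ((alive n).indicator
      fun ω : Path M => expectedTerminal P (pair n ω) (Lam n ω)) μ := by
    refine (Integrable.of_bound (C := C₂) ?_ (ae_of_all _ fun ω => h₂ _ _)).indicator
      (measurableSet_alive n)
    have hm : Measurable fun x : Feasible M × M.TimeToGo => expectedTerminal P x.1 x.2 :=
      measurable_from_prod_countable_right fun k => measurable_expectedTerminal hP k
    exact (hm.comp ((measurable_pair n).prodMk (measurable_Lam n))).aestronglyMeasurable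
  have i₃ : Integrable (fun ω : Path M => continuation Q u (pair n ω) (Lam n ω)) μ := by
    refine Integrable.of_bound (C := C₃) ?_ (ae_of_all _ fun ω => h₃ _ _)
    have hm : Measurable fun x : Feasible M × ℝ => continuation Q u x.1 x.2 :=
      measurable_from_prod_countable_right fun k => measurable_continuation hu k
    exact (hm.comp ((measurable_pair n).prodMk
      (measurable_subtype_coe.comp (measurable_Lam n)))).aestronglyMeasurable
  have i₄ : Integrable ((alive n ∩ {ω : Path M | (Lam n ω : ℝ) < X (n + 1) ω}).indicator
      fun ω => terminalReward (pair n ω) (executed ω)) μ := by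
    refine Integrable.of_bound (C := C₄) ((measurable_terminalReward_executed n).indicator
      ((measurableSet_alive n).inter (measurableSet_last n))).aestronglyMeasurable ?_
    filter_upwards [h.ae_executed_le hP n] with ω hω
    by_cases hB : ω ∈ alive n ∩ {ω | (Lam n ω : ℝ) < X (n + 1) ω}
    · rw [Set.indicator_of_mem hB]
      exact h₄ _ _ (hω hB.1 hB.2)
    · simpa [Set.indicator_of_notMem hB] using hC₄
  simp only [stageReward]
  rw [integral_add i₁ i₄, h.integral_terminal hP n, h.integral_extendZero_succ hu n,
    ← integral_add i₁ i₂, ← integral_add (by exact i₁.add i₂) i₃]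
  refine integral_congr_ae ?_
  filter_upwards [h.ae_action n] with ω hω
  by_cases h0 : ω ∈ alive n
  · have h0' : (0 : ℝ) ≤ Lam n ω := h0
    have hmem : (Lam n ω : ℝ) ∈ Set.Icc 0 M.T := ⟨h0', (Lam n ω).2⟩
    rw [extendZero_mem_Icc _ _ hmem, policyOp, bellman_eq hu]
    simp only [Set.indicator_of_mem h0]
    rw [hω]
    rfl
  · have h0' : (Lam n ω : ℝ) < 0 := not_le.1 h0
    simp only [Set.indicator_of_notMem h0]
    rw [extendZero_of_neg _ _ h0', continuation_of_neg _ _ h0']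
    simp

/-- The last epoch is folded into `u` by the one-step identity, so the induction must run over all
`u`. -/
theorem sum_integral_stageReward (hP : IsTerminalKernel Q P) (h : IsLaw Q P π e lam μ)
    (hu : IsBddMeasurable u) (N : ℕ) :
    ∑ n ∈ Finset.range N, ∫ ω, stageReward n ω ∂μ + ∫ ω, extendZero u (E N ω) (Lam N ω) ∂μ =
      policyIter Q P π N u e lam := by
  have := h.prob
  induction N generalizing u with
  | zero =>
    have h1 : ∀ᵐ ω ∂μ, extendZero u (E 0 ω) (Lam 0 ω) = u e lam := by
      filter_upwards [h.init] with ω hω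
      rw [hω.2.1, hω.2.2]
      exact extendZero_coe u e lam
    rw [integral_congr_ae h1]
    simp [policyIter]
  | succ N ih =>
    rw [Finset.sum_range_succ, add_assoc, h.integral_stageReward_add hP hu, policyIter]
    exact ih (isBddMeasurable_policyOp hP _ hu)

end IsLaw

/-! ### Geometric decay of the probability of being before maturity -/

section Decay

variable {Q : SemiMarkovKernel (Feasible M) (State M)} {μ : Measure (Path M)} {β : ℝ}

/-- The weight `e^λ`, cut off after maturity, is a Lyapunov function: its mean shrinks by `β` at
each epoch. It does not depend on the state, so `e` is arbitrary. -/
theorem continuation_exp_le (hβ : ∀ k, ∫ z, Real.exp (-(z.1 : ℝ)) ∂Q.jumpMeasure k ≤ β)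
    (k : Feasible M) (e : State M) {x : ℝ} (hx : x ≤ M.T) :
    continuation Q (fun _ (lam : M.Horizon) => Real.exp lam) k x ≤
      β * extendZero (fun _ (lam : M.Horizon) => Real.exp lam) e x := by
  rcases lt_or_ge x 0 with h | h
  · rw [continuation_of_neg _ _ h, extendZero_of_neg _ _ h, mul_zero]
  · have h1 := abs_continuation_sub_le hβ isBddMeasurable_exp isBddMeasurable_zero zero_le_one
      (fun e lam => by simp [abs_of_pos (Real.exp_pos _)]) k hx
    have h2 : continuation Q (fun _ (_ : M.Horizon) => (0 : ℝ)) k x = 0 := by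
      simp [continuation, extendZero]
    rw [h2, sub_zero, one_mul] at h1
    rw [extendZero_mem_Icc _ _ ⟨h, hx⟩]
    exact le_of_abs_le h1

theorem integrable_extendZero_Lam [IsProbabilityMeasure μ] {u : State M → M.Horizon → ℝ}
    (hu : IsBddMeasurable u) (n : ℕ) :
    Integrable (fun ω => extendZero u (E n ω) (Lam n ω)) μ := by
  obtain ⟨C, -, hC⟩ := hu.exists_abs_extendZero_le
  refine Integrable.of_bound (C := C) ?_ (ae_of_all _ fun ω => hC _ _)
  exact (hu.measurable_extendZero.comp ((measurable_E n).prodMk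
    (measurable_subtype_coe.comp (measurable_Lam n)))).aestronglyMeasurable

/-- The cut-off weight dominates the indicator of `alive n`, and its mean decays geometrically. The
recursion is taken as a hypothesis in place of `IsLaw` because the bound is also needed to prove the
`last_index` clause for the constructed measure. -/
theorem measureReal_alive_le [IsProbabilityMeasure μ] (hβ0 : 0 ≤ β)
    (hβ : ∀ k, ∫ z, Real.exp (-(z.1 : ℝ)) ∂Q.jumpMeasure k ≤ β)
    (hstep : ∀ n, ∫ ω, extendZero (fun _ (lam : M.Horizon) => Real.exp lam)
        (E (n + 1) ω) (Lam (n + 1) ω) ∂μ =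
      ∫ ω, continuation Q (fun _ (lam : M.Horizon) => Real.exp lam) (pair n ω) (Lam n ω) ∂μ)
    (n : ℕ) : μ.real (alive n) ≤ β ^ n * Real.exp M.T := by
  have hdecay : ∫ ω, extendZero (fun _ (lam : M.Horizon) => Real.exp lam) (E n ω) (Lam n ω) ∂μ ≤
      β ^ n * Real.exp M.T := by
    induction n with
    | zero =>
      refine (integral_mono (integrable_extendZero_Lam isBddMeasurable_exp 0)
        (integrable_const (Real.exp M.T)) fun ω => ?_).trans_eq (by simp)
      rcases lt_or_ge (Lam 0 ω : ℝ) 0 with h | h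
      · simp only [extendZero_of_neg _ _ h]
        positivity
      · simp only [extendZero_mem_Icc _ _ ⟨h, (Lam 0 ω).2⟩]
        exact Real.exp_le_exp.2 (Lam 0 ω).2
    | succ n ih =>
      rw [hstep, pow_succ, mul_comm (β ^ n), mul_assoc]
      refine le_trans ?_ (mul_le_mul_of_nonneg_left ih hβ0)
      rw [← integral_const_mul]
      refine integral_mono_of_nonneg (ae_of_all _ fun ω => ?_)
        ((integrable_extendZero_Lam isBddMeasurable_exp n).const_mul β)
        (ae_of_all _ fun ω => continuation_exp_le hβ _ _ (Lam n ω).2)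
      exact integral_nonneg fun z => Set.indicator_nonneg (fun _ _ => (Real.exp_pos _).le) _
  refine le_trans ?_ hdecay
  rw [← integral_indicator_one (measurableSet_alive n)]
  refine integral_mono ((integrable_const _).indicator (measurableSet_alive n))
    (integrable_extendZero_Lam isBddMeasurable_exp n) fun ω => ?_
  by_cases h : ω ∈ alive n
  · have h' : (0 : ℝ) ≤ Lam n ω := h
    rw [Set.indicator_of_mem h]
    simp only [extendZero_mem_Icc _ _ ⟨h', (Lam n ω).2⟩]
    exact Real.one_le_exp h'
  · rw [Set.indicator_of_notMem h]
    simp only [extendZero_of_neg _ _ (not_le.1 h)]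
    exact le_rfl

end Decay

theorem Path.measurable_comp_lastIndex {G : ℕ → Path M → ℝ} (hG : ∀ N, Measurable (G N)) :
    Measurable fun ω => G (lastIndex ω) ω := by
  have h : Measurable fun x : ℕ × Path M => G x.1 x.2 := measurable_from_prod_countable_right hG
  exact h.comp (measurable_lastIndex.prodMk measurable_id)

theorem Path.measurable_reward : Measurable (reward (M := M)) := by
  have hN : ∀ N : ℕ, Measurable fun ω : Path M => ∑ n ∈ Finset.range (N + 1),
      periodicReward (pair n ω) + terminalReward (pair N ω) (executed ω) := fun N =>
    (Finset.measurable_fun_sum _ fun n _ => measurable_periodicReward_pair n).add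
      (measurable_terminalReward_executed N)
  exact measurable_comp_lastIndex hN

/-! ### Integrability of the reward and its expectation as a limit -/

namespace IsLaw

variable {Q : SemiMarkovKernel (Feasible M) (State M)} {P : Kernel (Feasible M × M.TimeToGo) ℕ}
  {π : Policy M} {e : State M} {lam : M.Horizon} {μ : Measure (Path M)}
  {u : State M → M.Horizon → ℝ}

theorem exists_measureReal_alive_le (h : IsLaw Q P π e lam μ) :
    ∃ β : ℝ, 0 ≤ β ∧ β < 1 ∧ ∀ n, μ.real (alive n) ≤ β ^ n * Real.exp M.T := by
  have := h.prob
  obtain ⟨β, hβ0, hβ1, hβ⟩ := Q.exists_discount_integral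
  exact ⟨β, hβ0, hβ1, measureReal_alive_le hβ0 hβ
    fun n => h.integral_extendZero_succ isBddMeasurable_exp n⟩

/-- Times to maturity are nonincreasing along a path, so the epochs counted form an initial segment,
and a sojourn exceeding `Lam n` means precisely that epoch `n + 1` is no longer counted. -/
theorem ae_alive_iff (h : IsLaw Q P π e lam μ) :
    ∀ᵐ ω ∂μ, ∀ n, (ω ∈ alive n ↔ n ≤ lastIndex ω) ∧
      (ω ∈ alive n ∩ {ω | (Lam n ω : ℝ) < X (n + 1) ω} ↔ n = lastIndex ω) := by
  filter_upwards [h.last_index, ae_all_iff.2 h.time_step] with ω hN hstep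
  have hanti : Antitone fun n => (Lam n ω : ℝ) := antitone_nat_of_succ_le fun n => by
    rw [hstep n]
    exact sub_le_self _ (NNReal.coe_nonneg _)
  have key : ∀ n, ω ∈ alive n ↔ n ≤ lastIndex ω := fun n =>
    ⟨fun hn => hN.2 hn, fun hn => le_trans hN.1 (hanti hn)⟩
  refine fun n => ⟨key n, ?_⟩
  have h1 : (Lam n ω : ℝ) < X (n + 1) ω ↔ ω ∉ alive (n + 1) := by
    rw [alive, Set.mem_ofPred_eq, hstep n, sub_nonneg, not_le]
  rw [Set.mem_inter_iff, Set.mem_ofPred_eq, h1, key, key]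
  omega

theorem ae_reward_eq (h : IsLaw Q P π e lam μ) : ∀ᵐ ω ∂μ,
    reward ω = ∑ n ∈ Finset.range (lastIndex ω + 1), stageReward n ω ∧
      ∀ n ∉ Finset.range (lastIndex ω + 1), stageReward n ω = 0 := by
  filter_upwards [h.ae_alive_iff] with ω hω
  constructor
  · simp only [stageReward]
    rw [Finset.sum_add_distrib, reward]
    congr 1
    · refine Finset.sum_congr rfl fun n hn => ?_
      rw [Set.indicator_of_mem ((hω n).1.2 (Nat.lt_succ_iff.1 (Finset.mem_range.1 hn)))]
    · rw [Finset.sum_eq_single (lastIndex ω)]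
      · rw [Set.indicator_of_mem ((hω _).2.2 rfl)]
      · intro n _ hn
        rw [Set.indicator_of_notMem fun h => hn ((hω n).2.1 h)]
      · intro hn
        simp at hn
  · intro n hn
    simp only [Finset.mem_range, not_lt] at hn
    rw [stageReward, Set.indicator_of_notMem fun h => by have := (hω n).1.1 h; omega,
      Set.indicator_of_notMem fun h => by have := (hω n).2.1 h; omega, add_zero]

theorem exists_norm_stageReward_le (hP : IsTerminalKernel Q P) (h : IsLaw Q P π e lam μ) :
    ∃ C : ℝ, 0 ≤ C ∧ ∀ n, ∀ᵐ ω ∂μ, ‖stageReward n ω‖ ≤ (alive n).indicator (fun _ => C) ω := by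
  obtain ⟨C₁, h₁0, h₁⟩ := exists_abs_periodicReward_le M
  obtain ⟨C₂, h₂0, h₂⟩ := exists_abs_terminalReward_le M
  refine ⟨C₁ + C₂, by positivity, fun n => ?_⟩
  filter_upwards [h.ae_executed_le hP n] with ω hω
  rw [stageReward]
  by_cases ha : ω ∈ alive n
  · rw [Set.indicator_of_mem ha, Set.indicator_of_mem ha]
    refine (norm_add_le _ _).trans (add_le_add (h₁ _) ?_)
    by_cases hB : ω ∈ alive n ∩ {ω | (Lam n ω : ℝ) < X (n + 1) ω}
    · rw [Set.indicator_of_mem hB]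
      exact h₂ _ _ (hω hB.1 hB.2)
    · rw [Set.indicator_of_notMem hB, norm_zero]
      exact h₂0
  · rw [Set.indicator_of_notMem ha, Set.indicator_of_notMem ha,
      Set.indicator_of_notMem fun h => ha h.1, add_zero, norm_zero]

theorem integrable_stageReward (hP : IsTerminalKernel Q P) (h : IsLaw Q P π e lam μ) (n : ℕ) :
    Integrable (stageReward n) μ := by
  have := h.prob
  obtain ⟨C, -, hC⟩ := h.exists_norm_stageReward_le hP
  exact Integrable.mono' ((integrable_const C).indicator (measurableSet_alive n))
    (measurable_stageReward n).aestronglyMeasurable (hC n)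

/-- Stage rewards are uniformly bounded and vanish off `alive n`, whose probability decays
geometrically; this justifies exchanging sum and expectation. -/
theorem summable_integral_norm_stageReward (hP : IsTerminalKernel Q P)
    (h : IsLaw Q P π e lam μ) : Summable fun n => ∫ ω, ‖stageReward n ω‖ ∂μ := by
  have := h.prob
  obtain ⟨C, hC0, hC⟩ := h.exists_norm_stageReward_le hP
  obtain ⟨β, hβ0, hβ1, hβ⟩ := h.exists_measureReal_alive_le
  refine Summable.of_nonneg_of_le (fun n => integral_nonneg fun ω => norm_nonneg _) (fun n => ?_)
    (((summable_geometric_of_lt_one hβ0 hβ1).mul_right (Real.exp M.T)).mul_right C)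
  refine (integral_mono_ae (h.integrable_stageReward hP n).norm
    ((integrable_const C).indicator (measurableSet_alive n)) (hC n)).trans ?_
  rw [integral_indicator_const _ (measurableSet_alive n), smul_eq_mul]
  exact mul_le_mul_of_nonneg_right (hβ n) hC0

theorem hasSum_integral_stageReward (hP : IsTerminalKernel Q P) (h : IsLaw Q P π e lam μ) :
    HasSum (fun n => ∫ ω, stageReward n ω ∂μ) (∫ ω, reward ω ∂μ) := by
  have h1 : ∫ ω, reward ω ∂μ = ∫ ω, ∑' n, stageReward n ω ∂μ := by
    refine integral_congr_ae ?_
    filter_upwards [h.ae_reward_eq] with ω hω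
    rw [hω.1, tsum_eq_sum hω.2]
  rw [h1]
  exact hasSum_integral_of_summable_integral_norm (h.integrable_stageReward hP)
    (h.summable_integral_norm_stageReward hP)

theorem integrable_reward (hP : IsTerminalKernel Q P) (h : IsLaw Q P π e lam μ) :
    Integrable reward μ := by
  refine ⟨measurable_reward.aestronglyMeasurable, ?_⟩
  have h1 : ∫⁻ ω, ‖reward ω‖ₑ ∂μ ≤ ∫⁻ ω, ∑' n, ‖stageReward n ω‖ₑ ∂μ := by
    refine lintegral_mono_ae ?_
    filter_upwards [h.ae_reward_eq] with ω hω
    rw [hω.1]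
    exact (enorm_sum_le _ _).trans (ENNReal.sum_le_tsum _)
  refine h1.trans_lt ?_
  rw [lintegral_tsum fun n => (measurable_stageReward n).enorm.aemeasurable]
  have h2 : ∀ n, ∫⁻ ω, ‖stageReward n ω‖ₑ ∂μ = ENNReal.ofReal (∫ ω, ‖stageReward n ω‖ ∂μ) :=
    fun n => (ofReal_integral_norm_eq_lintegral_enorm (h.integrable_stageReward hP n)).symm
  simp only [h2]
  exact (h.summable_integral_norm_stageReward hP).tsum_ofReal_lt_top

/-- The expected reward is the limit of the iterated one-step operators of the policy. -/
theorem tendsto_policyIter (hP : IsTerminalKernel Q P) (h : IsLaw Q P π e lam μ)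
    (hu : IsBddMeasurable u) :
    Filter.Tendsto (fun N => policyIter Q P π N u e lam) Filter.atTop (𝓝 (∫ ω, reward ω ∂μ)) := by
  have := h.prob
  obtain ⟨C, hC0, hC⟩ := hu.exists_abs_extendZero_le
  obtain ⟨β, hβ0, hβ1, hβ⟩ := h.exists_measureReal_alive_le
  -- The remainder of the telescoped identity is at most a bound of `u` times the probability of
  -- `alive N`.
  have h1 : Filter.Tendsto (fun N => ∫ ω, extendZero u (E N ω) (Lam N ω) ∂μ) Filter.atTop
      (𝓝 0) := by
    have hlim : Filter.Tendsto (fun N : ℕ => β ^ N * Real.exp M.T * C) Filter.atTop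
        (𝓝 (0 * Real.exp M.T * C)) :=
      ((tendsto_pow_atTop_nhds_zero_of_lt_one hβ0 hβ1).mul_const _).mul_const _
    refine squeeze_zero_norm (fun N => ?_) (by simpa using hlim)
    have hle : ∀ ω : Path M, ‖extendZero u (E N ω) (Lam N ω)‖ ≤
        (alive N).indicator (fun _ => C) ω := by
      intro ω
      by_cases ha : ω ∈ alive N
      · rw [Set.indicator_of_mem ha]
        exact hC _ _
      · rw [Set.indicator_of_notMem ha, extendZero_of_neg _ _ (not_le.1 ha), norm_zero]
    refine (norm_integral_le_of_norm_le ((integrable_const C).indicator (measurableSet_alive N))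
      (ae_of_all _ hle)).trans ?_
    rw [integral_indicator_const _ (measurableSet_alive N), smul_eq_mul]
    exact mul_le_mul_of_nonneg_right (hβ N) hC0
  have h2 := (h.hasSum_integral_stageReward hP).tendsto_sum_nat.add h1
  rw [add_zero] at h2
  exact h2.congr fun N => h.sum_integral_stageReward hP hu N

end IsLaw

/-! ### Existence of a law -/

theorem condExp_eq_of_measure_inter {Ω : Type*} {m m₀ : MeasurableSpace Ω}
    {μ : Measure Ω} [IsFiniteMeasure μ] (hm : m ≤ m₀) {B : Set Ω} (hB : MeasurableSet B)
    {f : Ω → ℝ≥0∞} (hf : Measurable[m] f) (hf1 : ∀ ω, f ω ≤ 1)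
    (h : ∀ s, MeasurableSet[m] s → μ (s ∩ B) = ∫⁻ ω in s, f ω ∂μ) :
    μ⟦B | m⟧ =ᵐ[μ] fun ω => (f ω).toReal := by
  have hfm : StronglyMeasurable[m] fun ω => (f ω).toReal := hf.ennreal_toReal.stronglyMeasurable
  have hi : Integrable (fun ω => (f ω).toReal) μ := by
    refine Integrable.of_bound (C := 1) (hfm.mono hm).aestronglyMeasurable (ae_of_all _ fun ω => ?_)
    rw [Real.norm_of_nonneg ENNReal.toReal_nonneg]
    exact ENNReal.toReal_le_of_le_ofReal zero_le_one (by simpa using hf1 ω)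
  refine (ae_eq_condExp_of_forall_setIntegral_eq hm ((integrable_const _).indicator hB)
    (fun s _ _ => hi.integrableOn) (fun s hs _ => ?_) hfm.aestronglyMeasurable).symm
  rw [integral_toReal (hf.mono hm le_rfl).aemeasurable
    (ae_of_all _ fun ω => (hf1 ω).trans_lt ENNReal.one_lt_top), ← h s hs,
    setIntegral_indicator hB]
  simp [Measure.real]

/-! ### The kernel of a single noise -/

section Step

variable (Q : SemiMarkovKernel (Feasible M) (State M)) (P : Kernel (Feasible M × M.TimeToGo) ℕ)

open scoped Classical in
/-- The conditional law of the executed volume, given that the next epoch is after maturity. -/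
def executionKernel : Kernel (Feasible M × M.TimeToGo) ℕ where
  toFun x := if P x Set.univ = 0 then Measure.dirac 0 else (P x Set.univ)⁻¹ • P x
  measurable' := by
    refine Measurable.ite (P.measurable_coe MeasurableSet.univ (measurableSet_singleton 0))
      measurable_const (Measure.measurable_of_measurable_coe _ fun s hs => ?_)
    simp only [Measure.smul_apply, smul_eq_mul]
    exact (P.measurable_coe MeasurableSet.univ).inv.mul (P.measurable_coe hs)

variable (M) in
/-- Sojourn time, next state and candidate for the executed volume. -/
abbrev Noise : Type := (ℝ≥0 × State M) × ℕ

/-- The law of the noise driving one step of the process. -/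
def stepKernel : Kernel (Feasible M × M.TimeToGo) (Noise M) :=
  (Q.jumpKernel.comap Prod.fst measurable_fst) ×ₖ executionKernel P

variable {Q P}

/-- The mass identity is assumed for `λ > 0` only. At `λ = 0` it persists because `P` then has mass
`1` and `Q` has mass `0`. -/
theorem IsTerminalKernel.measure_univ (hP : IsTerminalKernel Q P) (k : Feasible M)
    (x : M.TimeToGo) (hx : 0 ≤ (x : ℝ)) :
    P (k, x) Set.univ = 1 - Q.kernel (x : ℝ).toNNReal k Set.univ := by
  rcases hx.eq_or_lt with h0 | h0
  · rw [← h0, Real.toNNReal_zero, Q.zero k _ MeasurableSet.univ, tsub_zero]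
    refine le_antisymm (hP.sub_markov _) ?_
    rw [← hP.of_nonpos k x h0.ge]
    exact measure_mono (Set.subset_univ _)
  · rw [← hP.of_pos k x h0, ← Measure.tsum_indicator_apply_singleton _ _ MeasurableSet.univ]
    simp

theorem isMarkovKernel_executionKernel (hP : IsTerminalKernel Q P) :
    IsMarkovKernel (executionKernel P) := by
  refine ⟨fun x => ⟨?_⟩⟩
  change (if P x Set.univ = 0 then Measure.dirac 0 else (P x Set.univ)⁻¹ • P x) Set.univ = 1
  split_ifs with h
  · simp
  · rw [Measure.smul_apply, smul_eq_mul,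
      ENNReal.inv_mul_cancel h ((hP.sub_markov x).trans_lt ENNReal.one_lt_top).ne]

/-- Multiplying by the mass undoes the normalisation; where the mass is zero both sides vanish, so
the default Dirac mass plays no role. -/
theorem mul_executionKernel (hP : IsTerminalKernel Q P) (x : Feasible M × M.TimeToGo)
    (s : Set ℕ) : P x Set.univ * executionKernel P x s = P x s := by
  change P x Set.univ * (if P x Set.univ = 0 then Measure.dirac 0 else
    (P x Set.univ)⁻¹ • P x) s = P x s
  split_ifs with h
  · rw [h, zero_mul, measure_mono_null (Set.subset_univ s) h]
  · rw [Measure.smul_apply, smul_eq_mul, ← mul_assoc,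
      ENNReal.mul_inv_cancel h ((hP.sub_markov x).trans_lt ENNReal.one_lt_top).ne, one_mul]

theorem stepKernel_prod (hP : IsTerminalKernel Q P) (k : Feasible M) (x : M.TimeToGo)
    (s : Set (ℝ≥0 × State M)) (t : Set ℕ) :
    stepKernel Q P (k, x) (s ×ˢ t) = Q.jumpMeasure k s * executionKernel P (k, x) t := by
  have := isMarkovKernel_executionKernel hP
  rw [stepKernel, Kernel.prod_apply, Measure.prod_prod, Kernel.comap_apply, Q.jumpKernel_apply]

/-- Jump and candidate volume are independent, and the probability of a sojourn beyond `x` is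
exactly the mass of `P (k, x)`, which cancels the normalisation. -/
theorem stepKernel_last (hP : IsTerminalKernel Q P) (k : Feasible M) (x : M.TimeToGo)
    (hx : 0 ≤ (x : ℝ)) (zz : ℕ) :
    stepKernel Q P (k, x) {y | (x : ℝ) < y.1.1 ∧ y.2 = zz} = P (k, x) {zz} := by
  have h1 : {y : Noise M | (x : ℝ) < y.1.1 ∧ y.2 = zz} =
      {z : ℝ≥0 × State M | (x : ℝ) < z.1} ×ˢ {zz} := by
    ext y
    simp
  have h2 : {z : ℝ≥0 × State M | (x : ℝ) < z.1} = {z | z.1 ≤ (x : ℝ).toNNReal}ᶜ := by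
    ext z
    simp only [Set.mem_ofPred_eq, Set.mem_compl_iff, not_le]
    rw [Real.toNNReal_lt_iff_lt_coe hx]
  rw [h1, stepKernel_prod hP, h2,
    prob_compl_eq_one_sub (measurableSet_le measurable_fst measurable_const),
    Q.jumpMeasure_le, ← hP.measure_univ k x hx, mul_executionKernel hP]

end Step

/-! ### Paths driven by a sequence of noises -/

namespace Noise

variable (π : Policy M) (lam : M.Horizon)

/-- Time to maturity at epoch `n`. -/
def lamSeq (s : ℕ → Noise M) (n : ℕ) : M.TimeToGo :=
  ⟨lam - ∑ i ∈ Finset.range n, ((s (i + 1)).1.1 : ℝ), by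
    have h : 0 ≤ ∑ i ∈ Finset.range n, ((s (i + 1)).1.1 : ℝ) :=
      Finset.sum_nonneg fun _ _ => NNReal.coe_nonneg _
    have := lam.2.2
    simp only [Set.mem_Iic]
    linarith⟩

/-- Feasible pair at epoch `n`. -/
def pairSeq (s : ℕ → Noise M) (n : ℕ) : Feasible M :=
  (π n).pair (s n).1.2 (lamSeq lam s n)

theorem lamSeq_zero (s : ℕ → Noise M) : lamSeq lam s 0 = lam.toTimeToGo := by
  apply Subtype.ext
  simp [lamSeq, Market.Horizon.toTimeToGo]

theorem lamSeq_succ (s : ℕ → Noise M) (n : ℕ) :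
    (lamSeq lam s (n + 1) : ℝ) = lamSeq lam s n - (s (n + 1)).1.1 := by
  simp only [lamSeq, Finset.sum_range_succ]
  ring

theorem lamSeq_antitone (s : ℕ → Noise M) : Antitone fun n => (lamSeq lam s n : ℝ) :=
  antitone_nat_of_succ_le fun n => by
    rw [lamSeq_succ]
    exact sub_le_self _ (NNReal.coe_nonneg _)

/-- The second alternative makes the search for the last epoch total, so that `last` is defined and
measurable on all sequences. -/
theorem exists_last (s : ℕ → Noise M) :
    ∃ n, (lamSeq lam s (n + 1) : ℝ) < 0 ∨ ∀ m, 0 ≤ (lamSeq lam s (m + 1) : ℝ) := by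
  by_cases h : ∃ n, (lamSeq lam s (n + 1) : ℝ) < 0
  · exact h.imp fun _ => Or.inl
  · push Not at h
    exact ⟨0, Or.inr h⟩

open scoped Classical in
/-- Index of the last epoch before maturity, or `0` if there are infinitely many. -/
def last (s : ℕ → Noise M) : ℕ := Nat.find (exists_last lam s)

theorem last_eq (s : ℕ → Noise M) {n : ℕ} (h0 : 0 ≤ (lamSeq lam s n : ℝ))
    (h1 : (lamSeq lam s (n + 1) : ℝ) < 0) : last lam s = n := by
  classical
  rw [last, Nat.find_eq_iff]
  refine ⟨Or.inl h1, fun i hi h => ?_⟩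
  rcases h with h | h
  · exact absurd (h0.trans (lamSeq_antitone lam s (Nat.succ_le_of_lt hi))) (not_le.2 h)
  · exact absurd (h n) (not_le.2 h1)

theorem isGreatest_last (s : ℕ → Noise M) {m : ℕ} (hm : (lamSeq lam s m : ℝ) < 0) :
    IsGreatest {n : ℕ | 0 ≤ (lamSeq lam s n : ℝ)} (last lam s) := by
  classical
  have hex : ∃ n, (lamSeq lam s n : ℝ) < 0 := ⟨m, hm⟩
  have h0 : Nat.find hex ≠ 0 := by
    intro h
    have := Nat.find_spec hex
    rw [h, lamSeq_zero] at this
    exact absurd lam.2.1 (not_le.2 this)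
  obtain ⟨n, hn⟩ := Nat.exists_eq_succ_of_ne_zero h0
  have h1 : (lamSeq lam s (n + 1) : ℝ) < 0 := by
    have := Nat.find_spec hex
    rwa [hn] at this
  have h2 : 0 ≤ (lamSeq lam s n : ℝ) := not_lt.1 (Nat.find_min hex (by omega))
  rw [last_eq lam s h2 h1]
  refine ⟨h2, fun i hi => ?_⟩
  by_contra! hlt
  exact absurd (le_trans hi (lamSeq_antitone lam s (Nat.succ_le_of_lt hlt))) (not_le.2 h1)

/-- The path driven by a sequence of noises. -/
def toPath (s : ℕ → Noise M) : Path M :=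
  (last lam s, (s (last lam s + 1)).2, fun n => ((s n).1.1, pairSeq π lam s n, lamSeq lam s n))

theorem measurable_lamSeq (n : ℕ) : Measurable fun s : ℕ → Noise M => lamSeq lam s n := by
  refine Measurable.subtype_mk (measurable_const.sub (Finset.measurable_fun_sum _ fun i _ => ?_))
  fun_prop

theorem measurable_pairSeq (n : ℕ) : Measurable fun s : ℕ → Noise M => pairSeq π lam s n := by
  refine (π n).measurable_pair.comp (Measurable.prodMk ?_ (measurable_lamSeq lam n))
  fun_prop

theorem measurable_last : Measurable (last (M := M) lam) := by
  classical
  refine measurable_find (exists_last lam) fun n => ?_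
  have h : ∀ n, Measurable fun s : ℕ → Noise M => (lamSeq lam s n : ℝ) :=
    fun n => measurable_subtype_coe.comp (measurable_lamSeq lam n)
  refine (measurableSet_lt (h (n + 1)) measurable_const).union ?_
  have hall : MeasurableSet (⋂ m, {s : ℕ → Noise M | 0 ≤ (lamSeq lam s (m + 1) : ℝ)}) :=
    MeasurableSet.iInter fun m => measurableSet_le measurable_const (h (m + 1))
  refine hall.congr ?_
  ext s
  rw [Set.mem_iInter]
  rfl

theorem measurable_toPath : Measurable (toPath π lam) := by
  have h1 : Measurable fun x : ℕ × (ℕ → Noise M) => (x.2 (x.1 + 1)).2 :=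
    measurable_from_prod_countable_right fun n => (measurable_pi_apply (n + 1)).snd
  refine (measurable_last lam).prodMk
    ((h1.comp ((measurable_last lam).prodMk measurable_id)).prodMk ?_)
  refine measurable_pi_lambda _ fun n => ?_
  refine Measurable.prodMk ?_ ((measurable_pairSeq π lam n).prodMk (measurable_lamSeq lam n))
  fun_prop

/-- Feasible pair and time to maturity at epoch `n`. -/
def stateSeq (n : ℕ) (s : ℕ → Noise M) : Feasible M × M.TimeToGo :=
  (pairSeq π lam s n, lamSeq lam s n)

theorem measurable_stateSeq (n : ℕ) : Measurable (stateSeq π lam n) :=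
  (measurable_pairSeq π lam n).prodMk (measurable_lamSeq lam n)

/-- Extend a finite sequence of noises. -/
def extend (e : State M) (n : ℕ) (h : (i : Finset.Iic n) → Noise M) : ℕ → Noise M :=
  fun i => if hi : i ≤ n then h ⟨i, Finset.mem_Iic.2 hi⟩ else ((0, e), 0)

theorem measurable_extend (e : State M) (n : ℕ) : Measurable (extend e n) := by
  refine measurable_pi_lambda _ fun i => ?_
  by_cases hi : i ≤ n
  · simp only [extend, hi, dif_pos]
    fun_prop
  · simp only [extend, hi, dif_neg, not_false_iff]
    fun_prop

theorem extend_frestrictLe (e : State M) {n i : ℕ} (hi : i ≤ n) (s : ℕ → Noise M) :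
    extend e n (Preorder.frestrictLe n s) i = s i := by
  simp [extend, hi]

theorem lamSeq_extend (e : State M) {n i : ℕ} (hi : i ≤ n) (s : ℕ → Noise M) :
    lamSeq lam (extend e n (Preorder.frestrictLe n s)) i = lamSeq lam s i := by
  apply Subtype.ext
  simp only [lamSeq]
  congr 1
  refine Finset.sum_congr rfl fun j hj => ?_
  rw [extend_frestrictLe e (by have := Finset.mem_range.1 hj; omega)]

theorem pairSeq_extend (e : State M) {n i : ℕ} (hi : i ≤ n) (s : ℕ → Noise M) :
    pairSeq π lam (extend e n (Preorder.frestrictLe n s)) i = pairSeq π lam s i := by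
  rw [pairSeq, pairSeq, lamSeq_extend lam e hi, extend_frestrictLe e hi]

/-- History and action at epoch `n` depend on the noises up to `n` only, so the filler used by
`extend` is never seen. Events of `histActSigma M n` thereby become cylinder events of the noise. -/
theorem hist_extend (e : State M) (n : ℕ) (s : ℕ → Noise M) :
    (Path.hist n (toPath π lam (extend e n (Preorder.frestrictLe n s))),
      Path.A n (toPath π lam (extend e n (Preorder.frestrictLe n s)))) =
    (Path.hist n (toPath π lam s), Path.A n (toPath π lam s)) := by
  have hX : ∀ i ≤ n, Path.X i (toPath π lam (extend e n (Preorder.frestrictLe n s))) =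
      Path.X i (toPath π lam s) := fun i hi => by
    simp only [Path.X, toPath, extend_frestrictLe e hi]
  have hp : ∀ i ≤ n, Path.pair i (toPath π lam (extend e n (Preorder.frestrictLe n s))) =
      Path.pair i (toPath π lam s) := fun i hi => by
    simp only [Path.pair, toPath, pairSeq_extend π lam e hi]
  have hL : ∀ i ≤ n, Path.Lam i (toPath π lam (extend e n (Preorder.frestrictLe n s))) =
      Path.Lam i (toPath π lam s) := fun i hi => by
    simp only [Path.Lam, toPath, lamSeq_extend lam e hi]
  simp only [Path.hist, Path.E, Path.A, hX n le_rfl, hp n le_rfl, hL n le_rfl]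
  congr 2
  funext i
  rw [hX i i.2.le, hp i i.2.le, hL i i.2.le]

variable (Q : SemiMarkovKernel (Feasible M) (State M)) (P : Kernel (Feasible M × M.TimeToGo) ℕ)

/-- The transition kernels of the sequence of noises. -/
def kernels (e : State M) (n : ℕ) : Kernel ((i : Finset.Iic n) → Noise M) (Noise M) :=
  (stepKernel Q P).comap (fun h => stateSeq π lam n (extend e n h))
    ((measurable_stateSeq π lam n).comp (measurable_extend e n))

variable {Q P}

theorem isMarkovKernel_kernels (hP : IsTerminalKernel Q P) (e : State M) (n : ℕ) :
    IsMarkovKernel (kernels π lam Q P e n) := by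
  have := isMarkovKernel_executionKernel hP
  unfold kernels stepKernel
  infer_instance

end Noise

/-! ### The Ionescu-Tulcea construction -/

open Preorder

namespace Noise

variable {π : Policy M} {lam : M.Horizon} {Q : SemiMarkovKernel (Feasible M) (State M)}
  {P : Kernel (Feasible M × M.TimeToGo) ℕ}

/-- The noise starts from the state `e`, and its conditional laws are given by `stepKernel`. -/
structure IsDriving (π : Policy M) (lam : M.Horizon) (Q : SemiMarkovKernel (Feasible M) (State M))
    (P : Kernel (Feasible M × M.TimeToGo) ℕ) (e : State M) (ν : Measure (ℕ → Noise M)) :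
    Prop where
  prob : IsProbabilityMeasure ν
  start : ∀ᵐ s ∂ν, s 0 = ((0, e), 0)
  step : ∀ (n : ℕ) (D : Set ((i : Finset.Iic n) → Noise M)), MeasurableSet D →
    ∀ G : Set ((Feasible M × M.TimeToGo) × Noise M), MeasurableSet G →
      ν (frestrictLe n ⁻¹' D ∩ {s | (stateSeq π lam n s, s (n + 1)) ∈ G}) =
        ∫⁻ s in frestrictLe n ⁻¹' D,
          stepKernel Q P (stateSeq π lam n s) (Prod.mk (stateSeq π lam n s) ⁻¹' G) ∂ν

theorem exists_isDriving (π : Policy M) (lam : M.Horizon) (hP : IsTerminalKernel Q P)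
    (e : State M) : ∃ ν, IsDriving π lam Q P e ν := by
  have := isMarkovKernel_kernels π lam hP e
  have := isMarkovKernel_executionKernel hP
  have : IsMarkovKernel (stepKernel Q P) := by unfold stepKernel; infer_instance
  let x₀ : (i : Finset.Iic 0) → Noise M := fun _ => ((0, e), 0)
  let ν : Measure (ℕ → Noise M) := Kernel.traj (X := fun _ => Noise M) (kernels π lam Q P e) 0 x₀
  refine ⟨ν, ⟨inferInstanceAs (IsProbabilityMeasure (Kernel.traj _ _ _)), ?_, ?_⟩⟩
  · have h1 : ν.map (frestrictLe 0) = Measure.dirac x₀ := by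
      rw [Kernel.traj_map_frestrictLe_apply, Kernel.partialTraj_self, Kernel.id_apply]
    have h2 : ∀ᵐ h ∂ν.map (frestrictLe 0), h ⟨0, by simp⟩ = ((0, e), 0) := by
      rw [h1, ae_dirac_iff]
      · exact measurable_pi_apply _ (measurableSet_singleton _)
    exact ae_of_ae_map (measurable_frestrictLe 0).aemeasurable h2
  · intro n D hD G hG
    let Y : ((i : Finset.Iic n) → Noise M) → Feasible M × M.TimeToGo :=
      fun h => stateSeq π lam n (extend e n h)
    have hY : Measurable Y := (measurable_stateSeq π lam n).comp (measurable_extend e n)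
    have hYs : ∀ s, Y (frestrictLe n s) = stateSeq π lam n s := fun s => by
      simp only [Y, stateSeq, pairSeq_extend π lam e le_rfl, lamSeq_extend lam e le_rfl]
    -- The Ionescu-Tulcea property: the first `n + 1` noises and the next one are joined by the
    -- `n`-th kernel.
    have hmap : (ν.map (frestrictLe n)) ⊗ₘ (kernels π lam Q P e n) =
        ν.map (fun s => (frestrictLe n s, s (n + 1))) := by
      rw [Kernel.traj_map_frestrictLe_apply]
      exact Kernel.partialTraj_compProd_eq_map_traj (Nat.zero_le n)
    let H : Set (((i : Finset.Iic n) → Noise M) × Noise M) :=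
      {z | z.1 ∈ D ∧ (Y z.1, z.2) ∈ G}
    have hH : MeasurableSet H :=
      (measurable_fst hD).inter (((hY.comp measurable_fst).prodMk measurable_snd) hG)
    have h1 : frestrictLe n ⁻¹' D ∩ {s | (stateSeq π lam n s, s (n + 1)) ∈ G} =
        (fun s : ℕ → Noise M => (frestrictLe n s, s (n + 1))) ⁻¹' H := by
      ext s
      simp only [Set.mem_inter_iff, Set.mem_preimage, Set.mem_ofPred_eq, H, hYs]
    have hms : Measurable fun s : ℕ → Noise M => (frestrictLe n s, s (n + 1)) :=
      (measurable_frestrictLe n).prodMk (measurable_pi_apply _)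
    have := Measure.isProbabilityMeasure_map (μ := ν)
      (measurable_frestrictLe (X := fun _ => Noise M) n).aemeasurable
    rw [h1, ← Measure.map_apply hms hH, ← hmap, Measure.compProd_apply hH,
      lintegral_map (Kernel.measurable_kernel_prodMk_left hH) (measurable_frestrictLe n),
      ← lintegral_indicator (measurable_frestrictLe n hD)]
    refine lintegral_congr fun s => ?_
    by_cases hs : s ∈ frestrictLe n ⁻¹' D
    · rw [Set.indicator_of_mem hs, ← hYs s]
      change stepKernel Q P (Y _) _ = _
      congr 1
      ext y
      simp only [Set.mem_preimage, H, Set.mem_ofPred_eq]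
      exact and_iff_right hs
    · rw [Set.indicator_of_notMem hs]
      refine measure_mono_null (fun y hy => hs hy.1) measure_empty

/-- The transition and terminal clauses both follow from this: an event decided by the current pair,
the time to maturity and the next noise has the step kernel of its section as conditional
probability. -/
theorem condExp_toPath (hP : IsTerminalKernel Q P) {e : State M} {ν : Measure (ℕ → Noise M)}
    (hν : IsDriving π lam Q P e ν) (n : ℕ) {B : Set (Path M)} (hB : MeasurableSet B)
    {G : Set ((Feasible M × M.TimeToGo) × Noise M)} (hG : MeasurableSet G)
    (hBG : ∀ s, toPath π lam s ∈ B ↔ (stateSeq π lam n s, s (n + 1)) ∈ G) :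
    (ν.map (toPath π lam))⟦B | histActSigma M n⟧ =ᵐ[ν.map (toPath π lam)]
      fun ω => (stepKernel Q P (pair n ω, Lam n ω)
        (Prod.mk (pair n ω, Lam n ω) ⁻¹' G)).toReal := by
  have := hν.prob
  have := isMarkovKernel_executionKernel hP
  have : IsMarkovKernel (stepKernel Q P) := by unfold stepKernel; infer_instance
  have hm := measurable_toPath π lam
  have := Measure.isProbabilityMeasure_map (μ := ν) hm.aemeasurable
  have hf : Measurable[histActSigma M n] fun ω : Path M =>
      stepKernel Q P (pair n ω, Lam n ω) (Prod.mk (pair n ω, Lam n ω) ⁻¹' G) :=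
    (Kernel.measurable_kernel_prodMk_left (κ := stepKernel Q P) hG).comp
      (measurable_pair_Lam_histActSigma n)
  refine condExp_eq_of_measure_inter (histActSigma_le n) hB hf (fun ω => prob_le_one) ?_
  rintro S ⟨S', hS', rfl⟩
  have hS := histActSigma_le (M := M) n _ ⟨S', hS', rfl⟩
  let D : Set ((i : Finset.Iic n) → Noise M) :=
    {h | (hist n (toPath π lam (extend e n h)), A n (toPath π lam (extend e n h))) ∈ S'}
  have hD : MeasurableSet D :=
    (((measurable_hist n).prodMk (measurable_A n)).comp (hm.comp (measurable_extend e n))) hS'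
  have hpre : toPath π lam ⁻¹' ((fun ω => (hist n ω, A n ω)) ⁻¹' S') = frestrictLe n ⁻¹' D := by
    ext s
    simp only [D, Set.mem_preimage, Set.mem_ofPred_eq, hist_extend]
  have hpre' : toPath π lam ⁻¹' B = {s | (stateSeq π lam n s, s (n + 1)) ∈ G} := by
    ext s
    exact hBG s
  rw [Measure.map_apply hm (hS.inter hB), Set.preimage_inter, hpre, hpre', hν.step n D hD G hG,
    setLIntegral_map hS (hf.mono (histActSigma_le n) le_rfl) hm, hpre]
  rfl

/-- The paths driven by the noise follow a law of the process. -/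
theorem IsDriving.isLaw (hP : IsTerminalKernel Q P) {e : State M} {ν : Measure (ℕ → Noise M)}
    (hν : IsDriving π lam Q P e ν) : IsLaw Q P π e lam (ν.map (toPath π lam)) := by
  have := hν.prob
  have := isMarkovKernel_executionKernel hP
  have hm := measurable_toPath π lam
  have hprob := Measure.isProbabilityMeasure_map (μ := ν) hm.aemeasurable
  have hLam : ∀ n, Measurable fun ω : Path M => (Lam n ω : ℝ) :=
    fun n => measurable_subtype_coe.comp (measurable_Lam n)
  have hX : ∀ n, Measurable fun ω : Path M => (X n ω : ℝ) :=
    fun n => measurable_subtype_coe.comp (measurable_X n)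
  have hstep : ∀ n, ∀ᵐ ω ∂ν.map (toPath π lam),
      (Lam (n + 1) ω : ℝ) = Lam n ω - X (n + 1) ω := fun n =>
    (ae_map_iff hm.aemeasurable
      (measurableSet_eq_fun (hLam (n + 1)) ((hLam n).sub (hX (n + 1))))).2
      (ae_of_all _ fun s => lamSeq_succ lam s n)
  have htrans : ∀ (n : ℕ) (t : ℝ≥0) (e' : State M),
      (ν.map (toPath π lam))⟦{ω | X (n + 1) ω ≤ t ∧ E (n + 1) ω = e'} | histActSigma M n⟧
        =ᵐ[ν.map (toPath π lam)] fun ω => (Q.kernel t (pair n ω) {e'}).toReal := by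
    intro n t e'
    have hB : MeasurableSet {ω : Path M | X (n + 1) ω ≤ t ∧ E (n + 1) ω = e'} :=
      (measurableSet_le (measurable_X _) measurable_const).inter
        (measurable_E _ (measurableSet_singleton e'))
    have hR : MeasurableSet ((Set.Iic t ×ˢ {e'}) ×ˢ Set.univ : Set (Noise M)) :=
      (measurableSet_Iic.prod (measurableSet_singleton e')).prod MeasurableSet.univ
    refine (condExp_toPath hP hν n hB (measurable_snd hR) fun s => ?_).trans
      (ae_of_all _ fun ω => ?_)
    · simp only [Set.mem_ofPred_eq, Set.mem_preimage, Set.mem_prod, Set.mem_Iic,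
        Set.mem_singleton_iff, Set.mem_univ, and_true]
      rfl
    · have : Prod.mk (pair n ω, Lam n ω) ⁻¹' (Prod.snd ⁻¹'
          ((Set.Iic t ×ˢ {e'}) ×ˢ Set.univ : Set (Noise M))) = (Set.Iic t ×ˢ {e'}) ×ˢ Set.univ := rfl
      simp only [this, stepKernel_prod hP, Q.jumpMeasure_Iic_prod, measure_univ, mul_one]
  refine ⟨hprob, ?_, hstep, ?_, ?_, htrans, ?_⟩
  · refine (ae_map_iff hm.aemeasurable ?_).2 ?_
    · exact (measurable_X 0 (measurableSet_singleton 0)).inter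
        ((measurable_E 0 (measurableSet_singleton e)).inter
          (measurable_Lam 0 (measurableSet_singleton lam.toTimeToGo)))
    · filter_upwards [hν.start] with s hs
      refine ⟨?_, ?_, lamSeq_zero lam s⟩
      · change (s 0).1.1 = 0
        rw [hs]
      · change (s 0).1.2 = e
        rw [hs]
  · obtain ⟨β, hβ0, hβ1, hβ⟩ := Q.exists_discount_integral
    -- Decay of the probability of `alive n` excludes infinitely many epochs before maturity, so the
    -- default value of `last` occurs only on a null set.
    have hle := measureReal_alive_le hβ0 hβ fun n =>
      integral_extendZero_succ_of_transition (htrans n) (hstep n) isBddMeasurable_exp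
    have hzero : (ν.map (toPath π lam)).real (⋂ n, alive n) = 0 := by
      refine le_antisymm (ge_of_tendsto' (x := Filter.atTop) (f := fun n : ℕ =>
        β ^ n * Real.exp M.T) ?_ fun n => ?_) measureReal_nonneg
      · simpa using (tendsto_pow_atTop_nhds_zero_of_lt_one hβ0 hβ1).mul_const (Real.exp M.T)
      · exact (measureReal_mono (Set.iInter_subset _ n)).trans (hle n)
    have hae : ∀ᵐ ω ∂ν.map (toPath π lam), ω ∉ ⋂ n, alive n :=
      measure_eq_zero_iff_ae_notMem.1 ((measureReal_eq_zero_iff (by finiteness)).1 hzero)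
    have h1 : ∀ᵐ s ∂ν, ∃ m, (lamSeq lam s m : ℝ) < 0 := by
      filter_upwards [ae_of_ae_map hm.aemeasurable hae] with s hs
      rw [Set.mem_iInter] at hs
      push Not at hs
      obtain ⟨m, hm⟩ := hs
      exact ⟨m, not_le.1 hm⟩
    have hset : MeasurableSet {ω : Path M | IsGreatest {n : ℕ | 0 ≤ (Lam n ω : ℝ)}
        (lastIndex ω)} := by
      have hN : ∀ N, MeasurableSet {ω : Path M | IsGreatest {n : ℕ | 0 ≤ (Lam n ω : ℝ)} N} := by
        intro N
        have : {ω : Path M | IsGreatest {n : ℕ | 0 ≤ (Lam n ω : ℝ)} N} =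
            alive N ∩ ⋂ n, ({ω | ω ∈ alive n → n ≤ N} : Set (Path M)) := by
          ext ω
          simp [IsGreatest, upperBounds, alive]
        rw [this]
        refine (measurableSet_alive N).inter (MeasurableSet.iInter fun n => ?_)
        exact (measurableSet_setOfPred.1 (measurableSet_alive n)).imp measurable_const |>.setOf
      have : {ω : Path M | IsGreatest {n : ℕ | 0 ≤ (Lam n ω : ℝ)} (lastIndex ω)} =
          ⋃ N, (lastIndex ⁻¹' {N} ∩ {ω | IsGreatest {n : ℕ | 0 ≤ (Lam n ω : ℝ)} N}) := by
        ext ω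
        simp
      rw [this]
      exact MeasurableSet.iUnion fun N =>
        (measurable_lastIndex (measurableSet_singleton N)).inter (hN N)
    refine (ae_map_iff hm.aemeasurable hset).2 ?_
    filter_upwards [h1] with s ⟨m, hm⟩
    exact isGreatest_last lam s hm
  · intro n a
    have hE : Measurable fun ω : Path M => (π n).toFun (E n ω) (Lam n ω) :=
      (π n).measurable.comp ((measurable_E n).prodMk (measurable_Lam n))
    have hset : MeasurableSet[histSigma M n] {ω : Path M | (π n).toFun (E n ω) (Lam n ω) = a} :=
      ((π n).measurable.comp (measurable_E_Lam_histSigma n)) (measurableSet_singleton a)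
    have hAE : ∀ᵐ ω ∂ν.map (toPath π lam), A n ω = (π n).toFun (E n ω) (Lam n ω) :=
      (ae_map_iff hm.aemeasurable (measurableSet_eq_fun (measurable_A n) hE)).2
        (ae_of_all _ fun s => rfl)
    have h1 : ({ω | A n ω = a} : Set (Path M)).indicator (fun _ => (1 : ℝ))
        =ᵐ[ν.map (toPath π lam)]
        ({ω | (π n).toFun (E n ω) (Lam n ω) = a} : Set (Path M)).indicator fun _ => (1 : ℝ) := by
      filter_upwards [hAE] with ω hω
      by_cases ha : A n ω = a
      · exact (Set.indicator_of_mem (s := {ω | A n ω = a}) ha _).trans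
          (Set.indicator_of_mem (s := {ω | (π n).toFun (E n ω) (Lam n ω) = a})
            (hω.symm.trans ha) fun _ => 1).symm
      · exact (Set.indicator_of_notMem (s := {ω | A n ω = a}) ha _).trans
          (Set.indicator_of_notMem (s := {ω | (π n).toFun (E n ω) (Lam n ω) = a})
            (fun h => ha (hω.trans h)) fun _ => 1).symm
    refine (condExp_congr_ae h1).trans ?_
    rw [condExp_of_stronglyMeasurable (histSigma_le n)
      (stronglyMeasurable_const.indicator hset)
      ((integrable_const _).indicator (histSigma_le n _ hset))]
  · intro n zz
    let G : Set ((Feasible M × M.TimeToGo) × Noise M) :=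
      {z | 0 ≤ (z.1.2 : ℝ) ∧ (z.1.2 : ℝ) < z.2.1.1 ∧ z.2.2 = zz}
    have hG : MeasurableSet G := by
      have h1 : Measurable fun z : (Feasible M × M.TimeToGo) × Noise M => (z.1.2 : ℝ) :=
        measurable_subtype_coe.comp measurable_fst.snd
      have h2 : Measurable fun z : (Feasible M × M.TimeToGo) × Noise M => (z.2.1.1 : ℝ) :=
        measurable_subtype_coe.comp measurable_snd.fst.fst
      exact (measurableSet_le measurable_const h1).inter ((measurableSet_lt h1 h2).inter
        (measurable_snd.snd (measurableSet_singleton zz)))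
    refine (condExp_toPath hP hν n (measurableSet_lastExecuted n zz) hG fun s => ?_).trans
      (ae_of_all _ fun ω => ?_)
    · change (0 ≤ (lamSeq lam s n : ℝ) ∧ (lamSeq lam s n : ℝ) < (s (n + 1)).1.1 ∧
        (s (last lam s + 1)).2 = zz) ↔ (0 ≤ (lamSeq lam s n : ℝ) ∧
          (lamSeq lam s n : ℝ) < (s (n + 1)).1.1 ∧ (s (n + 1)).2 = zz)
      refine and_congr_right fun h0 => and_congr_right fun h1 => ?_
      -- The path reads its executed volume from the noise leaving the last epoch. The two
      -- inequalities say that this epoch is `n`, so the noise in question has index `n + 1`.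
      rw [last_eq lam s h0 (by rw [lamSeq_succ]; linarith)]
    · by_cases h0 : 0 ≤ (Lam n ω : ℝ)
      · have hsec : Prod.mk (pair n ω, Lam n ω) ⁻¹' G =
            {y : Noise M | (Lam n ω : ℝ) < y.1.1 ∧ y.2 = zz} := by
          ext y
          simp [G, h0]
        simp only [hsec, stepKernel_last hP _ _ h0]
        exact (Set.indicator_of_mem (s := {ω : Path M | 0 ≤ (Lam n ω : ℝ)}) h0
          fun ω => (P (pair n ω, Lam n ω) {zz}).toReal).symm
      · have hsec : Prod.mk (pair n ω, Lam n ω) ⁻¹' G = ∅ := by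
          ext y
          simp [G, h0]
        simp only [hsec, measure_empty, ENNReal.toReal_zero]
        exact (Set.indicator_of_notMem (s := {ω : Path M | 0 ≤ (Lam n ω : ℝ)}) h0 _).symm

end Noise

theorem exists_isLaw {Q : SemiMarkovKernel (Feasible M) (State M)}
    {P : Kernel (Feasible M × M.TimeToGo) ℕ} (hP : IsTerminalKernel Q P) (π : Policy M)
    (e : State M) (lam : M.Horizon) : ∃ μ, IsLaw Q P π e lam μ := by
  obtain ⟨ν, hν⟩ := Noise.exists_isDriving π lam hP e
  exact ⟨_, hν.isLaw hP⟩

/-! ### Solutions of the optimality equation and the value function -/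

section Value

variable {Q : SemiMarkovKernel (Feasible M) (State M)} {P : Kernel (Feasible M × M.TimeToGo) ℕ}
  {u : State M → M.Horizon → ℝ}

/-- Two laws give limits of the same sequence of iterates started from zero, so the choice made in
`expectedReward` does not matter. -/
theorem IsLaw.integral_reward_eq (hP : IsTerminalKernel Q P) {π : Policy M} {e : State M}
    {lam : M.Horizon} {μ : Measure (Path M)} (h : IsLaw Q P π e lam μ) :
    ∫ ω, reward ω ∂μ = expectedReward Q P π e lam := by
  have hex : ∃ μ, IsLaw Q P π e lam μ := ⟨μ, h⟩
  rw [expectedReward, dif_pos hex]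
  exact tendsto_nhds_unique (h.tendsto_policyIter hP isBddMeasurable_zero)
    (hex.choose_spec.tendsto_policyIter hP isBddMeasurable_zero)

theorem tendsto_policyIter_expectedReward (hP : IsTerminalKernel Q P) (hu : IsBddMeasurable u)
    (π : Policy M) (e : State M) (lam : M.Horizon) :
    Filter.Tendsto (fun N => policyIter Q P π N u e lam) Filter.atTop
      (𝓝 (expectedReward Q P π e lam)) := by
  obtain ⟨μ, h⟩ := exists_isLaw hP π e lam
  rw [← h.integral_reward_eq hP]
  exact h.tendsto_policyIter hP hu

theorem IsBellmanSolution.expectedReward_le (hP : IsTerminalKernel Q P)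
    (hu : IsBellmanSolution Q P u) (π : Policy M) (e : State M) (lam : M.Horizon) :
    expectedReward Q P π e lam ≤ u e lam :=
  le_of_tendsto' (tendsto_policyIter_expectedReward hP hu.isBddMeasurable π e lam)
    fun N => hu.policyIter_le hP π N e lam

theorem expectedReward_stationary_eq (hP : IsTerminalKernel Q P) (hu : IsBddMeasurable u)
    {φ : DecisionRule M} (hφ : policyOp Q P φ u = u) (e : State M) (lam : M.Horizon) :
    expectedReward Q P (stationary φ) e lam = u e lam := by
  refine tendsto_nhds_unique (tendsto_policyIter_expectedReward hP hu _ e lam) ?_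
  simp only [policyIter_stationary_of_fixed hφ]
  exact tendsto_const_nhds

/-- The bound is attained by the stationary policy of a maximising rule. This also shows that the
real supremum defining the value function is a genuine one. -/
theorem IsBellmanSolution.isLUB (hP : IsTerminalKernel Q P) (hu : IsBellmanSolution Q P u)
    (e : State M) (lam : M.Horizon) :
    IsLUB (Set.range fun π : Policy M => expectedReward Q P π e lam) (u e lam) := by
  obtain ⟨φ, hφ⟩ := exists_maximising_decisionRule hP hu.isBddMeasurable
  refine IsGreatest.isLUB ⟨⟨stationary φ, ?_⟩, ?_⟩
  · exact expectedReward_stationary_eq hP hu.isBddMeasurable (hu.policyOp_eq hφ) e lam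
  · rintro _ ⟨π, rfl⟩
    exact hu.expectedReward_le hP π e lam

theorem IsBellmanSolution.eq_valueFunction (hP : IsTerminalKernel Q P)
    (hu : IsBellmanSolution Q P u) : u = valueFunction Q P := by
  funext e lam
  exact ((hu.isLUB hP e lam).ciSup_eq).symm

end Value

end Liquidation

end

theorem mainTheorem1 (M : Liquidation.Market)
    (Q : Liquidation.SemiMarkovKernel (Liquidation.Feasible M) (Liquidation.State M))
    (P : Kernel (Liquidation.Feasible M × M.TimeToGo) ℕ)
    (hP : Liquidation.IsTerminalKernel Q P) :
    (∀ (π : Liquidation.Policy M) (e : Liquidation.State M) (lam : M.Horizon),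
      (∃ μ, Liquidation.IsLaw Q P π e lam μ) ∧
      ∀ μ, Liquidation.IsLaw Q P π e lam μ →
        Integrable Liquidation.Path.reward μ ∧
        ∫ ω, Liquidation.Path.reward ω ∂μ = Liquidation.expectedReward Q P π e lam) ∧
    (∀ (e : Liquidation.State M) (lam : M.Horizon),
      IsLUB (Set.range fun π : Liquidation.Policy M => Liquidation.expectedReward Q P π e lam)
        (Liquidation.valueFunction Q P e lam)) ∧
    (Liquidation.IsBellmanSolution Q P (Liquidation.valueFunction Q P) ∧
      ∀ u : Liquidation.State M → M.Horizon → ℝ,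
        Liquidation.IsBellmanSolution Q P u → u = Liquidation.valueFunction Q P) ∧
    (∃ φ : Liquidation.DecisionRule M,
      Liquidation.IsGreedy Q P φ ∧ Liquidation.IsOptimal Q P (Liquidation.stationary φ)) ∧
    (∀ φ : Liquidation.DecisionRule M,
      Liquidation.IsGreedy Q P φ → Liquidation.IsOptimal Q P (Liquidation.stationary φ)) := by
  have key : ∃ u, Liquidation.IsBellmanSolution Q P u := Liquidation.exists_isBellmanSolution Q P hP
  obtain ⟨u, hu⟩ := key
  have huV := hu.eq_valueFunction hP
  -- Greediness refers to the value function; once that is known to be a solution, every greedy rule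
  -- fixes it and earns it.
  have hV : Liquidation.IsBellmanSolution Q P (Liquidation.valueFunction Q P) := huV ▸ hu
  have hopt : ∀ φ : Liquidation.DecisionRule M, Liquidation.IsGreedy Q P φ →
      Liquidation.IsOptimal Q P (Liquidation.stationary φ) := fun φ hφ =>
    Liquidation.expectedReward_stationary_eq hP hV.isBddMeasurable (hV.policyOp_eq hφ)
  refine ⟨fun π e lam => ⟨Liquidation.exists_isLaw hP π e lam, fun μ h =>
    ⟨h.integrable_reward hP, h.integral_reward_eq hP⟩⟩, hV.isLUB hP,
    ⟨hV, fun u hu => hu.eq_valueFunction hP⟩, ?_, hopt⟩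
  obtain ⟨φ, hφ⟩ := Liquidation.exists_maximising_decisionRule hP hV.isBddMeasurable
  exact ⟨φ, hφ, hopt φ hφ⟩
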